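/- Fix an integer $N\ge 1$ and let $p=p_F:=1+\frac2N$. For $0<\alpha<1$ consider $$\partial_t^\alpha u-\Delta u=u^p\ \text{ in }(0,T)\times\mathbb R^N,\qquad u(0)=\mu\ \text{ in }\mathbb R^N, \tag{P}$$ where $\partial_t^\alpha$ is the Caputo derivative and $\mu$ is a nonnegative Radon measure on $\mathbb R^N$; a nonnegative locally integrable function is identified with its density measure. Let $e^{t\Delta}\mu(x)=\int_{\mathbb R^N}(4\pi t)^{-N/2}e^{-|x-y|^2/(4t)}\,d\mu(y)$, let $h_\alpha(\theta)=\sum_{n\ge0}\frac{(-\theta)^n}{n!\,\Gamma(1-\alpha-\alpha n)}$ (with $1/\Gamma=0$ at the poles of $\Gamma$; this is a positive probability density on $(0,\infty)$, with $\int_0^\infty h_\alpha(\theta)e^{z\theta}d\theta=\sum_{k\ge 0} z^k/\Gamma(\alpha k+1)$), and $$P_\alpha(t)=\int_0^\infty h_\alpha(\theta)e^{t^\alpha\theta\Delta}\,d\theta,\qquad S_\alpha(t)=\int_0^\infty\theta h_\alpha(\theta)e^{t^\alpha\theta\Delta}\,d\theta .$$ For $0<T<\infty$, a nonnegative measurable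 function $u$ on $(0,T]\times\mathbb R^N$ is a solution of (P) in $[0,T]\times\mathbb R^N$ if $$\infty>u(t,x)=[P_\alpha(t)\mu](x)+\alpha\int_0^t(t-s)^{\alpha-1}[S_\alpha(t-s)u(s)^p](x)\,ds$$ for almost all $t\in(0,T]$ and $x\in\mathbb R^N$. It is the minimal solution if $u\le v$ almost everywhere for every solution $v$ in $[0,T]\times\mathbb R^N$. The life span is $$T_\alpha[\mu]:=\sup\{T'>0:\ \text{the minimal solution of (P) exists in }[0,T']\times\mathbb R^N\}\in[0,\infty].$$ For an integer $j\ge1$ let $\psi_j:=j\chi_{B(0,r_j)}$ with $r_j:=(j\omega_N)^{-1/N}$, where $\omega_N$ is the volume of the unit ball of $\mathbb R^N$. **Theorem.** There exists a function $\kappa_1:(0,1)\to(0,\infty)$ (depending on $N$) such that: 1. for every $\alpha\in(0,1)$ and every $\kappa>\kappa_1(\alpha)$ there is a constant $C_\kappa>0$ (depending on $N,\alpha,\kappa$ but not on $j$) with $$T_\alpha[\kappa\psi_j]\le C_\kappa\, j^{-\frac{2}{\alpha N}}\qquad\text{for all integers } j\ge1;$$ 2. $\kappa_1(\alpha)\simeq(1-\alpha)^{N/2}$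 as $\alpha\to1-0$, that is, there are constants $0<c\le C$ (depending on $N$) with $c(1-\alpha)^{N/2}\le\kappa_1(\alpha)\le C(1-\alpha)^{N/2}$ for all $\alpha<1$ sufficiently close to $1$; 3. for every $\alpha\in(0,1)$ there are $K>0$ and $C>0$ (depending on $N,\alpha$) such that for all $\kappa>K$ one can take $C_\kappa=C\kappa^{-\frac{2}{\alpha N}}$, that is, $T_\alpha[\kappa\psi_j]\le C\kappa^{-\frac{2}{\alpha N}}j^{-\frac{2}{\alpha N}}$ for all integers $j\ge1$. -/

import Mathlib

open MeasureTheory Set Filter Topology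
open scoped ENNReal

noncomputable section

namespace TimeFracHeat

/-- The space `ℝ^N` with its Euclidean norm and Lebesgue measure. -/
abbrev Space (N : ℕ) : Type := EuclideanSpace ℝ (Fin N)

/-- The heat kernel `G(t,x) = (4πt)^{-N/2} exp(-|x|²/(4t))`, for `t > 0`. -/
def heatKernel (N : ℕ) (t : ℝ) (x : Space N) : ℝ :=
  ((4 * Real.pi * t) ^ ((N : ℝ) / 2))⁻¹ * Real.exp (-(‖x‖ ^ 2) / (4 * t))

/-- `(e^{tΔ} μ)(x) = ∫ G(t, x - y) dμ(y)`, with values in `[0,∞]`. -/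
def heat {N : ℕ} (t : ℝ) (μ : Measure (Space N)) (x : Space N) : ℝ≥0∞ :=
  ∫⁻ y, ENNReal.ofReal (heatKernel N t (x - y)) ∂μ

/-- The probability density `h_α` on `(0,∞)`: the Wright-type (Mainardi) function
`h_α(θ) = ∑ₙ (-θ)ⁿ / (n! Γ(1 - α - αn))`, which is the density whose Laplace transform is
`∫₀^∞ h_α(θ) e^{zθ} dθ = E_{α,1}(z)`. The series converges for all real `θ` when `0 < α < 1`.
The reciprocal `1/Γ` is `0` at the poles of `Γ`, in agreement with the entire function `1/Γ`
(Mathlib sets `Γ` to `0` there, and `0⁻¹ = 0`). -/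
def wrightDensity (α θ : ℝ) : ℝ :=
  ∑' n : ℕ, (-θ) ^ n * ((n.factorial : ℝ)⁻¹ * (Real.Gamma (1 - α - α * n))⁻¹)

/-- `P_α(t) μ = ∫₀^∞ h_α(θ) e^{t^α θ Δ} μ dθ`. -/
def opP {N : ℕ} (α t : ℝ) (μ : Measure (Space N)) (x : Space N) : ℝ≥0∞ :=
  ∫⁻ θ in Ioi (0 : ℝ), ENNReal.ofReal (wrightDensity α θ) * heat (t ^ α * θ) μ x

/-- `S_α(t) μ = ∫₀^∞ θ h_α(θ) e^{t^α θ Δ} μ dθ`. -/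
def opS {N : ℕ} (α t : ℝ) (μ : Measure (Space N)) (x : Space N) : ℝ≥0∞ :=
  ∫⁻ θ in Ioi (0 : ℝ), ENNReal.ofReal (θ * wrightDensity α θ) * heat (t ^ α * θ) μ x

/-- The set `(0,T] × ℝ^N`. -/
def cylinder (N : ℕ) (T : ℝ) : Set (ℝ × Space N) := Ioc 0 T ×ˢ univ

/-- `u` is a solution in `[0,T] × ℝ^N` of `∂_t^α u - Δu = u^p`, `u(0) = μ`: it is a nonnegative
(Lebesgue) measurable function on `(0,T] × ℝ^N`, and for almost all `(t,x)` there
`∞ > u(t,x) = [P_α(t)μ](x) + α ∫₀ᵗ (t-s)^{α-1} [S_α(t-s) u(s)^p](x) ds`.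
The function `u(s)^p` is identified with the measure `u(s,y)^p dy`. -/
structure IsSolution {N : ℕ} (α p T : ℝ) (μ : Measure (Space N))
    (u : ℝ × Space N → ℝ≥0∞) : Prop where
  aemeasurable : AEMeasurable u (volume.restrict (cylinder N T))
  eqn : ∀ᵐ z ∂(volume.restrict (cylinder N T)),
    u z < ∞ ∧
    u z = opP α z.1 μ z.2 + ENNReal.ofReal α *
      ∫⁻ s in Ioo 0 z.1, ENNReal.ofReal ((z.1 - s) ^ (α - 1)) *
        opS α (z.1 - s) (volume.withDensity fun y => u (s, y) ^ p) z.2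

/-- The minimal solution in `[0,T] × ℝ^N`: a solution which lies almost everywhere below every
solution in `[0,T] × ℝ^N`. -/
def IsMinimalSolution {N : ℕ} (α p T : ℝ) (μ : Measure (Space N))
    (u : ℝ × Space N → ℝ≥0∞) : Prop :=
  IsSolution α p T μ u ∧
    ∀ v, IsSolution α p T μ v → ∀ᵐ z ∂(volume.restrict (cylinder N T)), u z ≤ v z

/-- The life span `T_α[μ] ∈ [0,∞]`: the supremum of all `T > 0` such that the minimal solution
exists in `[0,T] × ℝ^N`. -/
def lifespan {N : ℕ} (α p : ℝ) (μ : Measure (Space N)) : ℝ≥0∞ :=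
  sSup {τ | ∃ T : ℝ, 0 < T ∧ τ = ENNReal.ofReal T ∧ ∃ u, IsMinimalSolution α p T μ u}

/-- The Fujita exponent `p_F = 1 + 2/N`. -/
def fujita (N : ℕ) : ℝ := 1 + 2 / N

/-- `ω_N`, the volume of the unit ball of `ℝ^N`. -/
def unitBallVolume (N : ℕ) : ℝ := (volume (Metric.ball (0 : Space N) 1)).toReal

/-- `r_j = (j ω_N)^{-1/N}`. -/
def radius (N j : ℕ) : ℝ := ((j : ℝ) * unitBallVolume N) ^ (-(1 / (N : ℝ)))

/-- `ψ_j = j χ_{B(0,r_j)}`. -/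
def psi (N j : ℕ) : Space N → ℝ :=
  (Metric.ball (0 : Space N) (radius N j)).indicator fun _ => (j : ℝ)

/-- The initial datum `κ ψ_j`, identified with the measure `κ ψ_j(y) dy`. -/
def initialDatum (N : ℕ) (κ : ℝ) (j : ℕ) : Measure (Space N) :=
  volume.withDensity fun y => ENNReal.ofReal (κ * psi N j y)

end TimeFracHeat

end

noncomputable section

namespace TimeFracHeat

/-! ### Lower bounds for the heat kernel -/

/-! A solution dominates both its linear term and its Duhamel term, and the proof consists of lower
bounds on an arbitrary solution. The density `h_α` enters only through `WrightMass`: its positive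
part has mass at least `c` on some `(a, b]` with `a > 0`.

The datum `κψ_j` has mass `κ`, so from time `t₀ = r_j^{2/α}` on, `P_α` yields `u ≥ A t^{-αN/2}` on
the parabola `|x| < t^{α/2}`, with `A` proportional to `κ` (`parabolicLower_initial`). For `p = 1 +
2/N` the mass of `u(s)^p` in the parabola is at least a multiple of `A^p s^{-α}`. The Duhamel
integral over `(t₀, t/2)` then returns the same profile with `A` replaced by a multiple of `A ·
A^{2/N} / (1 - α)` (`ParabolicLower.step`). The factor `1 / (1 - α)` comes from integrating `s^{-α}`
and explains the threshold `κ ~ (1 - α)^{N/2}`: above it every step at least doubles `A`, while the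
starting time grows by the factor `4^{1/(1-α)}`. Neither this factor nor the number of steps depends
on `j`, so the bound keeps the scale `j^{-2/(αN)}` of `r_j^{2/α}`.

A large lower bound on a parabolic cylinder is fatal by `IsSolution.blow_up`: iterating the Duhamel
term there forces `u = ∞` on a set of positive measure. For large `κ` this applies at once to the
ball `B(0, r_j)`, which gives the explicit dependence on `κ`.

For the behaviour as `α → 1` the numbers `a, b, c` must be uniform in `α`, which
`wrightMass_uniform` extracts from an oscillatory integral for `∫₀^θ h_α`. Since `κ₁` need only be
some admissible threshold, it is then taken equal to a multiple of `(1 - α)^{N/2}` near `1`; no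
lower bound on the life span is involved. -/

theorem unitBallVolume_pos (N : ℕ) : 0 < unitBallVolume N :=
  ENNReal.toReal_pos (Metric.measure_ball_pos _ _ one_pos).ne' measure_ball_lt_top.ne

theorem volume_ball_eq {N : ℕ} (x : Space N) {R : ℝ} (hR : 0 < R) :
    volume (Metric.ball x R) = ENNReal.ofReal (R ^ N * unitBallVolume N) := by
  rw [Measure.addHaar_ball_of_pos _ _ hR, ENNReal.ofReal_mul (by positivity), unitBallVolume,
    ENNReal.ofReal_toReal measure_ball_lt_top.ne]
  simp

theorem heatKernel_lower {N : ℕ} {lo hi τ d : ℝ} {z : Space N} (hlo : 0 < lo) (h1 : lo ≤ τ)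
    (h2 : τ ≤ hi) (hd : ‖z‖ ^ 2 ≤ d) :
    ((4 * Real.pi * hi) ^ ((N : ℝ) / 2))⁻¹ * Real.exp (-d / (4 * lo)) ≤ heatKernel N τ z := by
  have hpi := Real.pi_pos
  have hτ : 0 < τ := hlo.trans_le h1
  unfold heatKernel
  refine mul_le_mul (by gcongr) (Real.exp_le_exp.2 ?_) (by positivity) (by positivity)
  have : 0 ≤ d := le_trans (by positivity) hd
  have h3 : ‖z‖ ^ 2 / (4 * τ) ≤ d / (4 * lo) := by gcongr
  rw [neg_div, neg_div]
  linarith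

theorem continuous_heatKernel (N : ℕ) (τ : ℝ) : Continuous (heatKernel N τ) := by
  unfold heatKernel
  fun_prop

theorem lintegral_heatKernel_lower {N : ℕ} {τ g : ℝ} {x : Space N} {s : Set (Space N)}
    (hs : MeasurableSet s) (hg : ∀ y ∈ s, g ≤ heatKernel N τ (x - y)) :
    ENNReal.ofReal g * volume s ≤ ∫⁻ y in s, ENNReal.ofReal (heatKernel N τ (x - y)) := by
  rw [← setLIntegral_const]
  exact setLIntegral_mono' hs fun y hy => ENNReal.ofReal_le_ofReal (hg y hy)

/-- The heat kernel carries a definite amount of mass to a ball at moderate distance. -/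
theorem lintegral_heatKernel_ball_lower {N : ℕ} {lo hi τ R X : ℝ} {x : Space N} (hlo : 0 < lo)
    (h1 : lo ≤ τ) (h2 : τ ≤ hi) (hR : 0 < R) (hx : ‖x‖ ≤ X) :
    ENNReal.ofReal (((4 * Real.pi * hi) ^ ((N : ℝ) / 2))⁻¹ * Real.exp (-(X + R) ^ 2 / (4 * lo)) *
        (R ^ N * unitBallVolume N)) ≤
      ∫⁻ y in Metric.ball 0 R, ENNReal.ofReal (heatKernel N τ (x - y)) := by
  have hpi := Real.pi_pos
  have hhi : 0 < hi := by linarith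
  rw [ENNReal.ofReal_mul (by positivity), ← volume_ball_eq (0 : Space N) hR]
  refine lintegral_heatKernel_lower measurableSet_ball fun y hy => ?_
  refine heatKernel_lower hlo h1 h2 ?_
  have hy' : ‖y‖ < R := by simpa using hy
  have := norm_sub_le x y
  gcongr
  linarith

/-- The lower bound in `lintegral_heatKernel_self_ball`. -/
def coneConst (N : ℕ) : ℝ :=
  ((4 * Real.pi) ^ ((N : ℝ) / 2))⁻¹ * Real.exp (-1 / 4) * ((1 / 2) ^ N * unitBallVolume N)

theorem coneConst_pos (N : ℕ) : 0 < coneConst N := by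
  have := unitBallVolume_pos N
  have hpi := Real.pi_pos
  unfold coneConst
  positivity

/-- Up to time `R ^ 2`, the heat flow of the indicator function of a ball of radius `R` stays
bounded below on that ball. -/
theorem lintegral_heatKernel_self_ball {N : ℕ} {τ R : ℝ} {x : Space N} (hτ : 0 < τ)
    (hτR : τ ≤ R ^ 2) (hR : 0 < R) (hx : ‖x‖ < R) :
    ENNReal.ofReal (coneConst N) ≤
      ∫⁻ y in Metric.ball 0 R, ENNReal.ofReal (heatKernel N τ (x - y)) := by
  have hpi := Real.pi_pos
  set q := √τ with hq
  have hq0 : 0 < q := Real.sqrt_pos.2 hτ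
  have hqq : q ^ 2 = τ := Real.sq_sqrt hτ.le
  have hqR : q ≤ R := by
    rw [hq]; exact Real.sqrt_le_iff.2 ⟨hR.le, hτR⟩
  -- Moving `x` towards the origin by `√τ / 2` gives a ball of radius `√τ / 2` that lies in `B(0,
  -- R)` and within distance `√τ` of `x`, where the kernel is comparable to `τ^{-N/2}`.
  obtain ⟨z, hz1, hz2⟩ : ∃ z : Space N, ‖x - z‖ ≤ q / 2 ∧ ‖z‖ ≤ R - q / 2 := by
    by_cases h : ‖x‖ ≤ q / 2
    · exact ⟨0, by simpa using h, by simp; linarith⟩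
    · push Not at h
      have hx0 : 0 < ‖x‖ := by linarith
      refine ⟨(1 - q / (2 * ‖x‖)) • x, ?_, ?_⟩
      · have : x - (1 - q / (2 * ‖x‖)) • x = (q / (2 * ‖x‖)) • x := by module
        rw [this, norm_smul, Real.norm_of_nonneg (by positivity)]
        apply le_of_eq
        field_simp
      · have h1 : 0 ≤ 1 - q / (2 * ‖x‖) := by
          rw [sub_nonneg, div_le_one (by positivity)]; linarith
        rw [norm_smul, Real.norm_of_nonneg h1]
        have : (1 - q / (2 * ‖x‖)) * ‖x‖ = ‖x‖ - q / 2 := by field_simp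
        rw [this]; linarith
  have hsub : Metric.ball z (q / 2) ⊆ Metric.ball 0 R := by
    intro y hy
    have : ‖y - z‖ < q / 2 := by simpa [dist_eq_norm] using hy
    have h2 := norm_add_le (y - z) z
    simp only [sub_add_cancel] at h2
    simp only [mem_ball_zero_iff]
    linarith
  refine le_trans ?_ (lintegral_mono_set hsub)
  refine le_trans ?_ (lintegral_heatKernel_lower measurableSet_ball
    (g := ((4 * Real.pi * τ) ^ ((N : ℝ) / 2))⁻¹ * Real.exp (-(q ^ 2) / (4 * τ))) ?_)
  · rw [volume_ball_eq _ (by positivity), ← ENNReal.ofReal_mul (by positivity)]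
    apply ENNReal.ofReal_le_ofReal
    apply le_of_eq
    unfold coneConst
    have e1 : -q ^ 2 / (4 * τ) = -1 / 4 := by rw [hqq]; field_simp
    have e2 : τ ^ ((N : ℝ) / 2) = q ^ N := by
      rw [← hqq, ← Real.rpow_natCast q N, ← Real.rpow_natCast q 2, ← Real.rpow_mul hq0.le]
      congr 1
      push_cast; ring
    rw [e1, Real.mul_rpow (by positivity) hτ.le, e2, div_pow, div_pow]
    field_simp
    simp
  · intro y hy
    refine heatKernel_lower hτ le_rfl le_rfl ?_
    have : ‖y - z‖ < q / 2 := by simpa [dist_eq_norm] using hy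
    have h2 : ‖x - y‖ ≤ ‖x - z‖ + ‖y - z‖ := by
      have := norm_sub_le (x - z) (y - z)
      simpa using this
    gcongr
    linarith

theorem heat_withDensity_lower {N : ℕ} {τ R : ℝ} {B : ℝ≥0∞} {x : Space N} {f : Space N → ℝ≥0∞}
    (hf : ∀ᵐ y : Space N, ‖y‖ < R → B ≤ f y) :
    B * ∫⁻ y in Metric.ball 0 R, ENNReal.ofReal (heatKernel N τ (x - y)) ≤
      heat τ (volume.withDensity f) x := by
  have hm : Measurable fun y : Space N => ENNReal.ofReal (heatKernel N τ (x - y)) := by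
    have := continuous_heatKernel N τ
    fun_prop
  have h1 : (Metric.ball (0 : Space N) R).indicator (fun _ => B) ≤ᵐ[volume] f := by
    filter_upwards [hf] with y hy
    by_cases h : y ∈ Metric.ball (0 : Space N) R
    · rw [indicator_of_mem h]; exact hy (by simpa using h)
    · rw [indicator_of_notMem h]; exact zero_le
  unfold heat
  refine le_trans ?_ (lintegral_mono' (withDensity_mono h1) le_rfl)
  rw [lintegral_withDensity_eq_lintegral_mul _ (measurable_const.indicator measurableSet_ball) hm,
    ← lintegral_const_mul _ hm, ← lintegral_indicator measurableSet_ball]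
  apply le_of_eq
  congr 1
  ext y
  by_cases h : y ∈ Metric.ball (0 : Space N) R <;> simp [h]

/-! ### The operators `P_α` and `S_α` -/

/-- The positive part of `h_α` has mass at least `c` on `(a, b]`. -/
structure WrightMass (α a b c : ℝ) : Prop where
  a_pos : 0 < a
  b_pos : 0 < b
  c_pos : 0 < c
  le_lintegral : ENNReal.ofReal c ≤ ∫⁻ θ in Ioc a b, ENNReal.ofReal (wrightDensity α θ)

/-- Discarding all `θ` outside `(a, b]` reduces `P_α` to the heat flow at times comparable to `t^α`.
In the analogue for `S_α` the extra weight `θ` costs only the factor `a`. -/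
theorem opP_lower {N : ℕ} {α a b c t : ℝ} {μ : Measure (Space N)} {x : Space N} {L : ℝ≥0∞}
    (hw : WrightMass α a b c) (hL : ∀ θ ∈ Ioc a b, L ≤ heat (t ^ α * θ) μ x) :
    ENNReal.ofReal c * L ≤ opP α t μ x := by
  have hsub : Ioc a b ⊆ Ioi 0 := fun θ hθ => hw.a_pos.trans hθ.1
  calc ENNReal.ofReal c * L ≤ (∫⁻ θ in Ioc a b, ENNReal.ofReal (wrightDensity α θ)) * L := by
        gcongr; exact hw.le_lintegral
    _ ≤ ∫⁻ θ in Ioc a b, ENNReal.ofReal (wrightDensity α θ) * L := lintegral_mul_const_le _ _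
    _ ≤ ∫⁻ θ in Ioc a b, ENNReal.ofReal (wrightDensity α θ) * heat (t ^ α * θ) μ x :=
        setLIntegral_mono' measurableSet_Ioc fun θ hθ => by gcongr; exact hL θ hθ
    _ ≤ opP α t μ x := lintegral_mono_set hsub

theorem opS_lower {N : ℕ} {α a b c t : ℝ} {μ : Measure (Space N)} {x : Space N} {L : ℝ≥0∞}
    (hw : WrightMass α a b c) (hL : ∀ θ ∈ Ioc a b, L ≤ heat (t ^ α * θ) μ x) :
    ENNReal.ofReal (a * c) * L ≤ opS α t μ x := by
  have ha := hw.a_pos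
  have hsub : Ioc a b ⊆ Ioi 0 := fun θ hθ => hw.a_pos.trans hθ.1
  calc ENNReal.ofReal (a * c) * L = ENNReal.ofReal c * (ENNReal.ofReal a * L) := by
        rw [ENNReal.ofReal_mul ha.le]; ring
    _ ≤ (∫⁻ θ in Ioc a b, ENNReal.ofReal (wrightDensity α θ)) * (ENNReal.ofReal a * L) := by
        gcongr; exact hw.le_lintegral
    _ ≤ ∫⁻ θ in Ioc a b, ENNReal.ofReal (wrightDensity α θ) * (ENNReal.ofReal a * L) :=
        lintegral_mul_const_le _ _
    _ ≤ ∫⁻ θ in Ioc a b, ENNReal.ofReal (θ * wrightDensity α θ) * heat (t ^ α * θ) μ x := by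
        refine setLIntegral_mono' measurableSet_Ioc fun θ hθ => ?_
        rw [ENNReal.ofReal_mul (ha.trans hθ.1).le, ← mul_assoc,
          mul_comm (ENNReal.ofReal (wrightDensity α θ))]
        gcongr
        · exact hθ.1.le
        · exact hL θ hθ
    _ ≤ opS α t μ x := lintegral_mono_set hsub

/-! ### Lower bounds for solutions -/

theorem IsSolution.ae_eqn {N : ℕ} {α p T : ℝ} {μ : Measure (Space N)} {u : ℝ × Space N → ℝ≥0∞}
    (hu : IsSolution α p T μ u) : ∀ᵐ z : ℝ × Space N, z.1 ∈ Ioc 0 T →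
      u z < ∞ ∧ opP α z.1 μ z.2 ≤ u z ∧ ENNReal.ofReal α *
      ∫⁻ s in Ioo 0 z.1, ENNReal.ofReal ((z.1 - s) ^ (α - 1)) *
        opS α (z.1 - s) (volume.withDensity fun y => u (s, y) ^ p) z.2 ≤ u z := by
  have h := hu.eqn
  rw [cylinder, ae_restrict_iff' (measurableSet_Ioc.prod MeasurableSet.univ)] at h
  filter_upwards [h] with z hz hz1
  have := hz ⟨hz1, mem_univ _⟩
  exact ⟨this.1, this.2 ▸ le_self_add, this.2 ▸ le_add_self⟩

/-- A lower bound for a solution on a space-time region improves to a lower bound at later times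
through the Duhamel term. -/
theorem IsSolution.duhamel_lower {N : ℕ} {α p T a b c τ₀ τ₁ : ℝ} {μ : Measure (Space N)}
    {u : ℝ × Space N → ℝ≥0∞} (hu : IsSolution α p T μ u) (hw : WrightMass α a b c)
    (hp : 0 ≤ p) (h0 : 0 ≤ τ₀) (h1 : τ₁ ≤ T) {f R : ℝ → ℝ}
    (hlow : ∀ᵐ z : ℝ × Space N, z.1 ∈ Ioo τ₀ τ₁ → ‖z.2‖ < R z.1 → ENNReal.ofReal (f z.1) ≤ u z) :
    -- The cutoff `σ` is `t` in the blow-up argument and `t / 2` in the self-similar one; `K` and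
    -- `σ` are quantified after the null set, so both may depend on `z`.
    ∀ᵐ z : ℝ × Space N, z.1 ∈ Ioo τ₀ τ₁ → ∀ σ ≤ z.1, ∀ K : ℝ → ℝ≥0∞,
      (∀ s ∈ Ioo τ₀ σ, ∀ θ ∈ Ioc a b, K s ≤ ∫⁻ y in Metric.ball 0 (R s),
        ENNReal.ofReal (heatKernel N ((z.1 - s) ^ α * θ) (z.2 - y))) →
      ENNReal.ofReal α * ∫⁻ s in Ioo τ₀ σ, ENNReal.ofReal ((z.1 - s) ^ (α - 1)) *
        (ENNReal.ofReal (a * c) * (ENNReal.ofReal (f s) ^ p * K s)) ≤ u z := by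
  have hs : ∀ᵐ s : ℝ, ∀ᵐ y : Space N, s ∈ Ioo τ₀ τ₁ → ‖y‖ < R s → ENNReal.ofReal (f s) ≤ u (s, y) :=
    Measure.ae_ae_of_ae_prod hlow
  filter_upwards [hu.ae_eqn] with z hz hz1 σ hσ K hK
  refine le_trans ?_ (hz ⟨h0.trans_lt hz1.1, hz1.2.le.trans h1⟩).2.2
  gcongr ENNReal.ofReal α * ?_
  refine le_trans ?_ (lintegral_mono_set (Ioo_subset_Ioo h0 hσ))
  refine lintegral_mono_ae ?_
  filter_upwards [ae_restrict_of_ae hs, ae_restrict_mem measurableSet_Ioo] with s hs hsm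
  gcongr
  refine opS_lower hw fun θ hθ => ?_
  refine le_trans ?_ (heat_withDensity_lower (R := R s) (B := ENNReal.ofReal (f s) ^ p) ?_)
  · gcongr
    exact hK s hsm θ hθ
  · filter_upwards [hs] with y hy hyR
    gcongr
    exact hy ⟨hsm.1, (hsm.2.trans_le hσ).trans hz1.2⟩ hyR

/-! ### The Wright function -/

/-- Euler's reflection formula. At the poles both sides vanish, by the convention `0⁻¹ = 0` on the
left. -/
theorem Gamma_one_sub_inv {z : ℝ} (hz : 0 < z) :
    (Real.Gamma (1 - z))⁻¹ = Real.Gamma z * Real.sin (Real.pi * z) / Real.pi := by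
  have h := Real.Gamma_mul_Gamma_one_sub z
  have hG := Real.Gamma_pos_of_pos hz
  have hpi := Real.pi_pos
  by_cases hs : Real.sin (Real.pi * z) = 0
  · rw [hs, div_zero] at h
    rcases mul_eq_zero.1 h with h | h
    · exact absurd h hG.ne'
    · simp [h, hs]
  · have hne : Real.Gamma (1 - z) ≠ 0 := by
      intro h0
      rw [h0, mul_zero, eq_comm, div_eq_zero_iff] at h
      rcases h with h | h
      · exact hpi.ne' h
      · exact hs h
    rw [eq_div_iff hs] at h
    rw [inv_eq_one_div, div_eq_div_iff hne hpi.ne']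
    linarith

/-- The coefficients of the power series of `h_α`. -/
def wrightCoeff (α : ℝ) (n : ℕ) : ℝ :=
  (n.factorial : ℝ)⁻¹ * (Real.Gamma (1 - α - α * n))⁻¹

theorem wrightCoeff_eq {α : ℝ} (hα : 0 < α) (n : ℕ) :
    wrightCoeff α n = (n.factorial : ℝ)⁻¹ *
      (Real.Gamma (α * (n + 1)) * Real.sin (Real.pi * (α * (n + 1))) / Real.pi) := by
  rw [wrightCoeff, ← Gamma_one_sub_inv (by positivity)]
  congr 3
  ring

theorem abs_wrightCoeff_le {α : ℝ} (hα : 0 < α) (n : ℕ) :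
    |wrightCoeff α n| ≤ (n.factorial : ℝ)⁻¹ * Real.Gamma (α * (n + 1)) / Real.pi := by
  have hG : 0 < Real.Gamma (α * (n + 1)) := Real.Gamma_pos_of_pos (by positivity)
  have hpi := Real.pi_pos
  rw [wrightCoeff_eq hα, abs_mul, abs_div, abs_mul, abs_of_pos hG, abs_of_pos hpi,
    abs_of_pos (by positivity : (0 : ℝ) < (n.factorial : ℝ)⁻¹), ← mul_div_assoc]
  gcongr
  exact mul_le_of_le_one_right hG.le (Real.abs_sin_le_one _)

/-- Split Euler's integral at `x = 1`: below, the power is at most `x^{α-1}`; above, it is at most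
`x^n`. The coefficients of `h_α` are therefore bounded, which gives control on `|θ| ≤ 1/2`. -/
theorem Gamma_le_inv_add_factorial {α : ℝ} (hα : 0 < α) (hα1 : α < 1) (n : ℕ) :
    Real.Gamma (α * (n + 1)) ≤ α⁻¹ + n.factorial := by
  have hz : 0 < α * (n + 1) := by positivity
  have hI : IntegrableOn (fun x : ℝ => x ^ (α - 1)) (Ioc 0 1) :=
    (intervalIntegrable_iff_integrableOn_Ioc_of_le zero_le_one).1
      (intervalIntegral.intervalIntegrable_rpow' (by linarith))
  have hI' : IntegrableOn ((Ioc (0 : ℝ) 1).indicator fun x : ℝ => x ^ (α - 1)) (Ioi 0) :=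
    ((integrable_indicator_iff measurableSet_Ioc).2 hI).integrableOn
  have hJ := Real.GammaIntegral_convergent (s := (n : ℝ) + 1) (by positivity)
  have e1 : ∫ x in Ioi (0 : ℝ), (Ioc (0 : ℝ) 1).indicator (fun x : ℝ => x ^ (α - 1)) x = α⁻¹ := by
    rw [setIntegral_indicator measurableSet_Ioc,
      inter_eq_self_of_subset_right Ioc_subset_Ioi_self,
      ← intervalIntegral.integral_of_le zero_le_one, integral_rpow (Or.inl (by linarith))]
    simp [Real.zero_rpow hα.ne']
  rw [← e1, ← Real.Gamma_nat_eq_factorial, Real.Gamma_eq_integral hz,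
    Real.Gamma_eq_integral (by positivity), ← integral_add hI' hJ]
  refine setIntegral_mono_on (Real.GammaIntegral_convergent hz) (hI'.add hJ) measurableSet_Ioi ?_
  intro x hx
  have hx0 : (0 : ℝ) < x := hx
  by_cases h : x ≤ 1
  · rw [indicator_of_mem (mem_Ioc.2 ⟨hx0, h⟩)]
    have h1 : x ^ (α * (n + 1) - 1) ≤ x ^ (α - 1) := by
      apply Real.rpow_le_rpow_of_exponent_ge hx0 h
      have : 0 ≤ α * n := by positivity
      linarith
    have h2 : Real.exp (-x) ≤ 1 := Real.exp_le_one_iff.2 (by linarith)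
    have h3 : 0 ≤ Real.exp (-x) * x ^ ((n : ℝ) + 1 - 1) := by positivity
    have h4 : Real.exp (-x) * x ^ (α * (n + 1) - 1) ≤ 1 * x ^ (α - 1) := by gcongr
    linarith
  · rw [indicator_of_notMem (fun hx' : x ∈ Ioc (0 : ℝ) 1 => h hx'.2), zero_add]
    push Not at h
    have : α * ((n : ℝ) + 1) ≤ (n : ℝ) + 1 := mul_le_of_le_one_left (by positivity) hα1.le
    gcongr
    exact h.le

theorem abs_wrightCoeff_le_const {α : ℝ} (hα : 0 < α) (hα1 : α < 1) (n : ℕ) :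
    |wrightCoeff α n| ≤ (α⁻¹ + 1) / Real.pi := by
  have hpi := Real.pi_pos
  refine (abs_wrightCoeff_le hα n).trans ?_
  gcongr
  have hf : (1 : ℝ) ≤ n.factorial := by exact_mod_cast n.factorial_pos
  rw [inv_mul_le_iff₀ (by positivity)]
  have h := Gamma_le_inv_add_factorial hα hα1 n
  have : α⁻¹ ≤ n.factorial * α⁻¹ := le_mul_of_one_le_left (by positivity) hf
  nlinarith

theorem wrightDensity_eq_tsum (α θ : ℝ) :
    wrightDensity α θ = ∑' n : ℕ, (-θ) ^ n * wrightCoeff α n := rfl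

theorem norm_wright_term_le {α θ r : ℝ} (hα : 0 < α) (hα1 : α < 1) (hθ : |θ| ≤ r) (n : ℕ) :
    ‖(-θ) ^ n * wrightCoeff α n‖ ≤ r ^ n * ((α⁻¹ + 1) / Real.pi) := by
  rw [norm_mul, norm_pow, norm_neg, Real.norm_eq_abs, Real.norm_eq_abs]
  have hr : 0 ≤ r := (abs_nonneg θ).trans hθ
  exact mul_le_mul (pow_le_pow_left₀ (abs_nonneg θ) hθ n) (abs_wrightCoeff_le_const hα hα1 n)
    (abs_nonneg _) (by positivity)

theorem abs_wrightDensity_le {α θ : ℝ} (hα : 0 < α) (hα1 : α < 1) (hθ : |θ| ≤ 1 / 2) :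
    |wrightDensity α θ| ≤ 2 * ((α⁻¹ + 1) / Real.pi) := by
  have h := (hasSum_geometric_of_lt_one (r := (1 / 2 : ℝ)) (by norm_num) (by norm_num)).mul_right
    ((α⁻¹ + 1) / Real.pi)
  have h2 := tsum_of_norm_bounded h (norm_wright_term_le hα hα1 hθ)
  rw [wrightDensity_eq_tsum, ← Real.norm_eq_abs]
  refine h2.trans (le_of_eq ?_)
  norm_num

theorem continuousOn_wrightDensity {α : ℝ} (hα : 0 < α) (hα1 : α < 1) :
    ContinuousOn (wrightDensity α) (Icc (-(1 / 2)) (1 / 2)) := by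
  have h := (summable_geometric_of_lt_one (r := (1 / 2 : ℝ)) (by norm_num) (by norm_num)).mul_right
    ((α⁻¹ + 1) / Real.pi)
  refine continuousOn_tsum (fun n => by fun_prop) h fun n θ hθ => ?_
  exact norm_wright_term_le hα hα1 (abs_le.2 hθ) n

theorem wrightDensity_zero (α : ℝ) : wrightDensity α 0 = (Real.Gamma (1 - α))⁻¹ := by
  rw [wrightDensity_eq_tsum, tsum_eq_single 0 (fun n hn => by simp [hn])]
  simp [wrightCoeff]

/-- Continuity at `0` suffices, because `h_α(0) = 1/Γ(1-α) > 0`. This value tends to `0` as `α → 1`,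
so the constants found here are not uniform. -/
theorem exists_wrightMass {α : ℝ} (hα : 0 < α) (hα1 : α < 1) :
    ∃ a b c, WrightMass α a b c := by
  have h0 : 0 < wrightDensity α 0 := by
    rw [wrightDensity_zero]
    exact inv_pos.2 (Real.Gamma_pos_of_pos (by linarith))
  have hc : ContinuousAt (wrightDensity α) 0 :=
    (continuousOn_wrightDensity hα hα1).continuousAt (Icc_mem_nhds (by norm_num) (by norm_num))
  obtain ⟨δ, hδ, h⟩ := Metric.eventually_nhds_iff.1
    (hc.eventually (lt_mem_nhds (half_lt_self h0)))
  refine ⟨δ / 4, δ / 2, wrightDensity α 0 / 2 * (δ / 4), by positivity, by positivity,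
    by positivity, ?_⟩
  calc ENNReal.ofReal (wrightDensity α 0 / 2 * (δ / 4))
      = ∫⁻ θ in Ioc (δ / 4) (δ / 2), ENNReal.ofReal (wrightDensity α 0 / 2) := by
        rw [setLIntegral_const, Real.volume_Ioc, ENNReal.ofReal_mul (by positivity)]
        congr 2
        ring
    _ ≤ _ := by
        refine setLIntegral_mono' measurableSet_Ioc fun θ hθ => ENNReal.ofReal_le_ofReal ?_
        refine (h ?_).le
        rw [Real.dist_eq, sub_zero, abs_of_pos (by linarith [hθ.1])]
        linarith [hθ.2]

/-! ### The distribution function of `h_α` -/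

theorem hasSum_of_forall_eq {f g : ℕ → ℝ} {a : ℝ} (h : ∀ n, f n = g n) (hg : HasSum g a) :
    HasSum f a := by
  rwa [funext h]

theorem hasSum_pow_succ_div_factorial (x : ℝ) :
    HasSum (fun n : ℕ => x ^ (n + 1) / ((n + 1).factorial : ℝ)) (Real.exp x - 1) := by
  have h := NormedSpace.expSeries_div_hasSum_exp x
  rw [← Real.exp_eq_exp_ℝ] at h
  simpa using (hasSum_nat_add_iff' 1).2 h

/-- This is the imaginary part of the exponential series at `-x e^{iφ}`, without its real constant
term. -/
theorem hasSum_pow_succ_mul_sin (x φ : ℝ) :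
    HasSum (fun n : ℕ => (-x) ^ (n + 1) / ((n + 1).factorial : ℝ) * Real.sin (φ * (n + 1)))
      (-(Real.exp (-x * Real.cos φ) * Real.sin (x * Real.sin φ))) := by
  have h := NormedSpace.expSeries_div_hasSum_exp ((-x : ℝ) * Complex.exp (φ * Complex.I))
  rw [← Complex.exp_eq_exp_ℂ] at h
  have h2 := Complex.hasSum_im h
  have h3 := (hasSum_nat_add_iff' 1).2 h2
  have e1 : ((-x : ℝ) * Complex.exp (φ * Complex.I)).re = -x * Real.cos φ := by
    rw [Complex.re_ofReal_mul, Complex.exp_ofReal_mul_I_re]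
  have e2 : ((-x : ℝ) * Complex.exp (φ * Complex.I)).im = -x * Real.sin φ := by
    rw [Complex.im_ofReal_mul, Complex.exp_ofReal_mul_I_im]
  have e3 : ∀ n : ℕ, (((-x : ℝ) * Complex.exp (φ * Complex.I)) ^ n / (n.factorial : ℂ)).im =
      (-x) ^ n / (n.factorial : ℝ) * Real.sin (φ * n) := by
    intro n
    rw [mul_pow, ← Complex.exp_nat_mul, mul_div_right_comm]
    have : (n : ℂ) * (φ * Complex.I) = ((φ * n : ℝ) : ℂ) * Complex.I := by push_cast; ring
    rw [this, show ((-x : ℝ) : ℂ) ^ n / (n.factorial : ℂ) =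
      (((-x) ^ n / (n.factorial : ℝ) : ℝ) : ℂ) by push_cast; ring, Complex.im_ofReal_mul,
      Complex.exp_ofReal_mul_I_im]
  simp only [e3, Complex.exp_im, e1, e2] at h3
  simpa using h3

/-- Since `α < 1`, the growth of `e^{θ r^α}` is absorbed by half of the decay of `e^{-r}`. -/
theorem exists_mul_rpow_le {α : ℝ} (hα : 0 < α) (hα1 : α < 1) {θ : ℝ} (hθ : 0 < θ) :
    ∃ M : ℝ, ∀ r : ℝ, 0 < r → θ * r ^ α ≤ r / 2 + M := by
  set R := (2 * θ) ^ (1 / (1 - α)) with hR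
  have hR0 : 0 < R := by positivity
  refine ⟨θ * R ^ α, fun r hr => ?_⟩
  rcases le_total r R with h | h
  · have : θ * r ^ α ≤ θ * R ^ α := by gcongr
    linarith
  · have h1 : 2 * θ ≤ r ^ (1 - α) := by
      have : R ^ (1 - α) = 2 * θ := by
        rw [hR, ← Real.rpow_mul (by positivity), one_div, inv_mul_cancel₀ (by linarith),
          Real.rpow_one]
      rw [← this]
      gcongr
    have h2 : r ^ (1 - α) * r ^ α = r := by
      rw [← Real.rpow_add hr]; simp
    have h3 : 0 < r ^ α := by positivity
    have : 0 < θ * R ^ α := by positivity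
    nlinarith

/-- The `n`-th term of the expansion of `e^{-r} (e^{θ r^α} - 1) / r`. -/
def wrightBound (α θ : ℝ) (n : ℕ) (r : ℝ) : ℝ :=
  Real.exp (-r) * r ^ (α * (n + 1) - 1) * (θ ^ (n + 1) / ((n + 1).factorial : ℝ))

theorem rpow_mul_succ_sub_one {α r : ℝ} (hr : 0 < r) (n : ℕ) :
    r ^ (α * (n + 1) - 1) = r⁻¹ * (r ^ α) ^ (n + 1) := by
  rw [Real.rpow_sub hr, Real.rpow_one, Real.rpow_mul hr.le, div_eq_inv_mul, ← Real.rpow_natCast]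
  push_cast
  rfl

theorem hasSum_wrightBound {α θ r : ℝ} (hr : 0 < r) :
    HasSum (fun n => wrightBound α θ n r) (Real.exp (-r) * r⁻¹ * (Real.exp (θ * r ^ α) - 1)) := by
  refine hasSum_of_forall_eq (fun n => ?_)
    ((hasSum_pow_succ_div_factorial (θ * r ^ α)).mul_left (Real.exp (-r) * r⁻¹))
  rw [wrightBound, rpow_mul_succ_sub_one hr, mul_pow]
  ring

theorem integrableOn_tsum_wrightBound {α θ : ℝ} (hα : 0 < α) (hα1 : α < 1) (hθ : 0 < θ) :
    IntegrableOn (fun r => ∑' n, wrightBound α θ n r) (Ioi 0) := by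
  obtain ⟨M, hM⟩ := exists_mul_rpow_le hα hα1 hθ
  have h1 : IntegrableOn (fun r : ℝ => θ * Real.exp M * (r ^ (α - 1) * Real.exp (-(1 / 2) * r ^ (1 : ℝ))))
      (Ioi 0) :=
    (integrableOn_rpow_mul_exp_neg_mul_rpow (by linarith) one_pos (by norm_num)).const_mul _
  have h2 : IntegrableOn (fun r : ℝ => Real.exp (-r) * r⁻¹ * (Real.exp (θ * r ^ α) - 1)) (Ioi 0) := by
    refine Integrable.mono' h1 (by fun_prop) ?_
    filter_upwards [ae_restrict_mem measurableSet_Ioi] with r hr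
    have hr0 : (0 : ℝ) < r := hr
    have hX : 0 < θ * r ^ α := by positivity
    have h3 : 0 ≤ Real.exp (θ * r ^ α) - 1 := by linarith [Real.one_le_exp hX.le]
    have h4 : Real.exp (θ * r ^ α) - 1 ≤ θ * r ^ α * Real.exp (θ * r ^ α) := by
      have h5 := Real.add_one_le_exp (-(θ * r ^ α))
      have h6 := Real.exp_pos (θ * r ^ α)
      have h7 : Real.exp (-(θ * r ^ α)) * Real.exp (θ * r ^ α) = 1 := by
        rw [← Real.exp_add]; simp
      nlinarith
    rw [Real.norm_of_nonneg (by positivity), Real.rpow_one]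
    calc Real.exp (-r) * r⁻¹ * (Real.exp (θ * r ^ α) - 1)
        ≤ Real.exp (-r) * r⁻¹ * (θ * r ^ α * Real.exp (θ * r ^ α)) := by gcongr
      _ ≤ Real.exp (-r) * r⁻¹ * (θ * r ^ α * Real.exp (r / 2 + M)) := by
          gcongr; exact hM r hr0
      _ = _ := by
          have : Real.exp (r / 2 + M) * Real.exp (-r) = Real.exp M * Real.exp (-(1 / 2) * r) := by
            rw [← Real.exp_add, ← Real.exp_add]; ring_nf
          rw [Real.rpow_sub hr0, Real.rpow_one]
          linear_combination r⁻¹ * θ * r ^ α * this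
  refine h2.congr_fun (fun r hr => ?_) measurableSet_Ioi
  exact (hasSum_wrightBound hr).tsum_eq.symm

theorem integral_wrightBound {α : ℝ} (hα : 0 < α) (θ : ℝ) (n : ℕ) :
    ∫ r in Ioi 0, wrightBound α θ n r =
      Real.Gamma (α * (n + 1)) * (θ ^ (n + 1) / ((n + 1).factorial : ℝ)) := by
  rw [Real.Gamma_eq_integral (by positivity), ← integral_mul_const]
  rfl

theorem aestronglyMeasurable_wrightBound (α θ : ℝ) (n : ℕ) :
    AEStronglyMeasurable (wrightBound α θ n) (volume.restrict (Ioi 0)) := by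
  unfold wrightBound
  fun_prop

theorem wrightBound_nonneg {α θ r : ℝ} (hθ : 0 ≤ θ) (hr : 0 ≤ r) (n : ℕ) :
    0 ≤ wrightBound α θ n r := by
  unfold wrightBound
  positivity

/-- The terms are the integrals of `wrightBound`, whose pointwise sum is integrable. No asymptotics
of `Γ` are needed. -/
theorem summable_Gamma_mul {α θ : ℝ} (hα : 0 < α) (hα1 : α < 1) (hθ : 0 < θ) :
    Summable fun n : ℕ => Real.Gamma (α * (n + 1)) * (θ ^ (n + 1) / ((n + 1).factorial : ℝ)) := by
  have h := hasSum_integral_of_dominated_convergence (μ := volume.restrict (Ioi (0 : ℝ)))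
    (F := wrightBound α θ) (wrightBound α θ) (aestronglyMeasurable_wrightBound α θ)
    (fun n => by
      filter_upwards [ae_restrict_mem measurableSet_Ioi] with r hr
      exact (Real.norm_of_nonneg (wrightBound_nonneg hθ.le (le_of_lt hr) n)).le)
    (by
      filter_upwards [ae_restrict_mem measurableSet_Ioi] with r hr
      exact (hasSum_wrightBound hr).summable)
    (integrableOn_tsum_wrightBound hα hα1 hθ)
    (by
      filter_upwards [ae_restrict_mem measurableSet_Ioi] with r hr
      exact hasSum_wrightBound hr)
  simpa only [integral_wrightBound hα] using h.summable

theorem summable_pow_mul_wrightCoeff {α θ : ℝ} (hα : 0 < α) (hα1 : α < 1) (hθ : 0 < θ) :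
    Summable fun n : ℕ => θ ^ n * |wrightCoeff α n| := by
  have hpi := Real.pi_pos
  refine Summable.of_nonneg_of_le (fun n => by positivity) (fun n => ?_)
    -- Doubling `θ` pays for the quotient `(n+1)! / n! = n + 1 ≤ 2^(n+1)`.
    ((summable_Gamma_mul hα hα1 (by positivity : 0 < 2 * θ)).mul_left (θ * Real.pi)⁻¹)
  have hG : 0 < Real.Gamma (α * (n + 1)) := Real.Gamma_pos_of_pos (by positivity)
  have hn : ((n : ℝ) + 1) ≤ 2 ^ (n + 1) := by exact_mod_cast (Nat.lt_two_pow_self (n := n + 1)).le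
  calc θ ^ n * |wrightCoeff α n|
      ≤ θ ^ n * ((n.factorial : ℝ)⁻¹ * Real.Gamma (α * (n + 1)) / Real.pi) := by
        gcongr; exact abs_wrightCoeff_le hα n
    _ = (θ * Real.pi)⁻¹ * (Real.Gamma (α * (n + 1)) *
          (((n : ℝ) + 1) * θ ^ (n + 1) / ((n + 1).factorial : ℝ))) := by
        rw [Nat.factorial_succ]
        push_cast
        field_simp
        rw [pow_succ]
    _ ≤ _ := by
        rw [mul_pow]
        gcongr

theorem hasSum_integral_wrightDensity {α θ : ℝ} (hα : 0 < α) (hα1 : α < 1) (hθ : 0 < θ) :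
    IntervalIntegrable (wrightDensity α) volume 0 θ ∧
    HasSum (fun n : ℕ => (-1) ^ n * (θ ^ (n + 1) / (n + 1)) * wrightCoeff α n)
      (∫ x in (0 : ℝ)..θ, wrightDensity α x) := by
  have hs := summable_pow_mul_wrightCoeff hα hα1 hθ
  have hb : ∀ (n : ℕ) (x : ℝ), x ∈ Icc 0 θ → ‖(-x) ^ n * wrightCoeff α n‖ ≤ θ ^ n * |wrightCoeff α n| := by
    intro n x hx
    rw [norm_mul, norm_pow, norm_neg, Real.norm_eq_abs, Real.norm_eq_abs, abs_of_nonneg hx.1]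
    gcongr
    exacts [hx.1, hx.2]
  constructor
  · refine ContinuousOn.intervalIntegrable_of_Icc hθ.le ?_
    exact continuousOn_tsum (fun n => by fun_prop) hs hb
  · have h := intervalIntegral.hasSum_integral_of_dominated_convergence (μ := volume) (a := 0) (b := θ)
      (F := fun n x => (-x) ^ n * wrightCoeff α n) (f := wrightDensity α)
      (fun n _ => θ ^ n * |wrightCoeff α n|)
      (fun n => by fun_prop)
      (fun n => ae_of_all _ fun x hx => by
        rw [uIoc_of_le hθ.le] at hx
        exact hb n x ⟨hx.1.le, hx.2⟩)
      (ae_of_all _ fun x _ => hs) intervalIntegrable_const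
      (ae_of_all _ fun x hx => by
        rw [uIoc_of_le hθ.le] at hx
        exact (Summable.of_norm_bounded hs fun n => hb n x ⟨hx.1.le, hx.2⟩).hasSum)
    refine hasSum_of_forall_eq (fun n => ?_) h
    rw [intervalIntegral.integral_mul_const]
    congr 1
    have : ∀ x : ℝ, (-x) ^ n = (-1) ^ n * x ^ n := fun x => by rw [neg_pow]
    rw [funext this]
    simp only [intervalIntegral.integral_const_mul, integral_pow]
    simp

/-- The distribution function of `h_α` as an oscillatory integral. -/
theorem integral_wrightDensity_eq {α θ : ℝ} (hα : 0 < α) (hα1 : α < 1) (hθ : 0 < θ) :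
    IntegrableOn (fun r => Real.exp (-r) * r⁻¹ * (Real.exp (-(θ * r ^ α) * Real.cos (Real.pi * α)) *
        Real.sin (θ * r ^ α * Real.sin (Real.pi * α)))) (Ioi 0) ∧
    ∫ x in (0 : ℝ)..θ, wrightDensity α x = Real.pi⁻¹ * ∫ r in Ioi 0, Real.exp (-r) * r⁻¹ *
      (Real.exp (-(θ * r ^ α) * Real.cos (Real.pi * α)) *
        Real.sin (θ * r ^ α * Real.sin (Real.pi * α))) := by
  have hle : ∀ n : ℕ, ∀ r : ℝ, 0 < r →
      ‖(-1) ^ n * Real.sin (Real.pi * α * (n + 1)) * wrightBound α θ n r‖ ≤ wrightBound α θ n r := by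
    intro n r hr
    have h0 := wrightBound_nonneg (α := α) hθ.le hr.le n
    rw [norm_mul, Real.norm_of_nonneg h0]
    refine mul_le_of_le_one_left h0 ?_
    rw [norm_mul, norm_pow, norm_neg, norm_one, one_pow, one_mul]
    exact Real.abs_sin_le_one _
  have hpt : ∀ r : ℝ, 0 < r → HasSum (fun n : ℕ => (-1) ^ n * Real.sin (Real.pi * α * (n + 1)) *
      wrightBound α θ n r) (Real.exp (-r) * r⁻¹ * (Real.exp (-(θ * r ^ α) * Real.cos (Real.pi * α)) *
        Real.sin (θ * r ^ α * Real.sin (Real.pi * α)))) := by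
    intro r hr
    have h0 := (hasSum_pow_succ_mul_sin (θ * r ^ α) (Real.pi * α)).mul_left
      (-(Real.exp (-r) * r⁻¹))
    rw [neg_mul_neg] at h0
    refine hasSum_of_forall_eq (fun n => ?_) h0
    rw [wrightBound, rpow_mul_succ_sub_one hr, neg_pow (θ * r ^ α), mul_pow, pow_succ (-1 : ℝ)]
    ring
  -- Each `Γ(α(n+1))` is written as an integral over `r`; after exchanging sum and integral, the
  -- series in `n` is the sine series of `hasSum_pow_succ_mul_sin` with `φ = πα`.
  have h := hasSum_integral_of_dominated_convergence (μ := volume.restrict (Ioi (0 : ℝ)))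
    (F := fun (n : ℕ) r => (-1) ^ n * Real.sin (Real.pi * α * (n + 1)) * wrightBound α θ n r)
    (wrightBound α θ) (fun n => (aestronglyMeasurable_wrightBound α θ n).const_mul _)
    (fun n => by
      filter_upwards [ae_restrict_mem measurableSet_Ioi] with r hr
      exact hle n r hr)
    (by
      filter_upwards [ae_restrict_mem measurableSet_Ioi] with r hr
      exact (hasSum_wrightBound hr).summable)
    (integrableOn_tsum_wrightBound hα hα1 hθ)
    (by
      filter_upwards [ae_restrict_mem measurableSet_Ioi] with r hr
      exact hpt r hr)
  simp only [integral_const_mul, integral_wrightBound hα] at h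
  constructor
  · refine Integrable.mono' (integrableOn_tsum_wrightBound hα hα1 hθ) (by fun_prop) ?_
    filter_upwards [ae_restrict_mem measurableSet_Ioi] with r hr
    rw [← (hpt r hr).tsum_eq]
    exact tsum_of_norm_bounded (hasSum_wrightBound hr).summable.hasSum fun n => hle n r hr
  · refine (hasSum_integral_wrightDensity hα hα1 hθ).2.unique ?_
    refine hasSum_of_forall_eq (fun n => ?_) (h.mul_left Real.pi⁻¹)
    rw [wrightCoeff_eq hα, Nat.factorial_succ]
    push_cast
    field_simp

/-! ### Mass of `h_α` uniformly as `α → 1` -/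

/-- A minorant of the sine chosen so that its integral against `e^{-y} dy / y` is explicit and
positive, namely `(2 - 1) / π`. -/
theorem quadratic_le_sin {y : ℝ} (hy : 0 ≤ y) : (2 * y - y ^ 2) / Real.pi ≤ Real.sin y := by
  have hpi := Real.pi_pos
  have hpi4 : Real.pi < 4 := by linarith [Real.pi_lt_d2]
  have hpi3 := Real.pi_gt_three
  rw [div_le_iff₀ hpi]
  rcases le_total y (Real.pi / 2) with h | h
  · have h1 := Real.mul_le_sin hy h
    have h2 : 2 / Real.pi * y * Real.pi ≤ Real.sin y * Real.pi := by gcongr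
    rw [mul_right_comm, div_mul_cancel₀ _ hpi.ne'] at h2
    nlinarith
  rcases le_total y Real.pi with h' | h'
  · have h1 := Real.mul_le_sin (x := Real.pi - y) (by linarith) (by linarith)
    rw [Real.sin_pi_sub] at h1
    have h2 : 2 / Real.pi * (Real.pi - y) * Real.pi ≤ Real.sin y * Real.pi := by gcongr
    rw [mul_right_comm, div_mul_cancel₀ _ hpi.ne'] at h2
    nlinarith [sq_nonneg (y - 2)]
  · have h1 := Real.sin_le (x := y - Real.pi) (by linarith)
    rw [Real.sin_sub_pi] at h1
    nlinarith

theorem integral_rpow_mul_exp_neg_quadratic {α l : ℝ} (hα : 0 < α) (hl : 0 < l) :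
    IntegrableOn (fun r => r⁻¹ * (Real.exp (-(l * r ^ α)) *
      ((2 * (l * r ^ α) - (l * r ^ α) ^ 2) / Real.pi))) (Ioi 0) ∧
    ∫ r in Ioi 0, r⁻¹ * (Real.exp (-(l * r ^ α)) *
      ((2 * (l * r ^ α) - (l * r ^ α) ^ 2) / Real.pi)) = (Real.pi * α)⁻¹ := by
  have hpi := Real.pi_pos
  have i1 := integrableOn_rpow_mul_exp_neg_mul_rpow (s := α - 1) (p := α) (b := l)
    (by linarith) hα hl
  have i2 := integrableOn_rpow_mul_exp_neg_mul_rpow (s := 2 * α - 1) (p := α) (b := l)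
    (by linarith) hα hl
  have e : ∀ r ∈ Ioi (0 : ℝ), 2 * l / Real.pi * (r ^ (α - 1) * Real.exp (-l * r ^ α)) -
      l ^ 2 / Real.pi * (r ^ (2 * α - 1) * Real.exp (-l * r ^ α)) = r⁻¹ * (Real.exp (-(l * r ^ α)) *
      ((2 * (l * r ^ α) - (l * r ^ α) ^ 2) / Real.pi)) := by
    intro r hr
    have hr0 : (0 : ℝ) < r := hr
    rw [Real.rpow_sub hr0, Real.rpow_sub hr0, Real.rpow_one, mul_comm 2 α, Real.rpow_mul hr0.le,
      Real.rpow_two]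
    field_simp
  have i3 := Integrable.sub (Integrable.const_mul i1 (2 * l / Real.pi))
    (Integrable.const_mul i2 (l ^ 2 / Real.pi))
  refine ⟨IntegrableOn.congr_fun i3 e measurableSet_Ioi, ?_⟩
  rw [← setIntegral_congr_fun measurableSet_Ioi e, integral_sub (i1.const_mul _) (i2.const_mul _),
    integral_const_mul, integral_const_mul,
    integral_rpow_mul_exp_neg_mul_rpow hα (by linarith) hl,
    integral_rpow_mul_exp_neg_mul_rpow hα (by linarith) hl]
  have e1 : -(α - 1 + 1) / α = -1 := by field_simp; ring
  have e2 : (α - 1 + 1) / α = 1 := by field_simp; ring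
  have e3 : -(2 * α - 1 + 1) / α = -2 := by field_simp; ring
  have e4 : (2 * α - 1 + 1) / α = 2 := by field_simp; ring
  rw [e1, e2, e3, e4, Real.Gamma_one, Real.Gamma_two, Real.rpow_neg hl.le, Real.rpow_neg hl.le,
    Real.rpow_one, Real.rpow_two]
  field_simp
  norm_num

/-- For `α` close to `1`, a fixed amount of the mass of `h_α` lies in a fixed interval. -/
theorem exists_integral_wrightDensity_ge {α : ℝ} (hα : 1 / 2 < α) (hα1 : α < 1) :
    ∃ θ, 1 / 2 ≤ θ ∧ θ ≤ Real.exp Real.pi ∧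
      (Real.pi ^ 2)⁻¹ ≤ ∫ x in (0 : ℝ)..θ, wrightDensity α x := by
  have hpi := Real.pi_pos
  have hpi3 := Real.pi_gt_three
  have hα0 : 0 < α := by linarith
  set s := Real.sin (Real.pi * α) with hs
  set k := -Real.cos (Real.pi * α) with hk
  have hs0 : 0 < s := Real.sin_pos_of_pos_of_lt_pi (by positivity) (by nlinarith)
  have hk0 : 0 < k := by
    rw [hk, neg_pos]
    exact Real.cos_neg_of_pi_div_two_lt_of_lt (by nlinarith) (by nlinarith)
  have hsk : s ^ 2 + k ^ 2 = 1 := by rw [hk, neg_sq]; exact Real.sin_sq_add_cos_sq _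
  have hs1 : s ≤ 1 := Real.sin_le_one _
  have hk1 : k ≤ 1 := by nlinarith
  have hks1 : 1 ≤ k + s := by nlinarith
  have hs2 : 2 * (1 - α) ≤ s := by
    have h1 := Real.mul_le_sin (x := Real.pi - Real.pi * α) (by nlinarith) (by nlinarith)
    rw [Real.sin_pi_sub] at h1
    refine le_trans (le_of_eq ?_) h1
    field_simp
  -- With `y = θ s r^α`, the integrand is `r⁻¹ e^{-r + θ k r^α} sin y`. The pair `(r₁, θ)` makes `y
  -- = π` and `-r + θ k r^α = -y` hold simultaneously at `r = r₁`. Before `r₁` the sine is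
  -- nonnegative and the exponent is at least `-y`; after `r₁` the quadratic minorant is nonpositive
  -- and the exponent is at most `-y`. Either way the integrand is at least `r⁻¹ e^{-y} (2y - y²) /
  -- π`.
  set r₁ := Real.pi * (k + s) / s with hr₁
  have hr₁1 : 1 ≤ r₁ := by
    rw [hr₁, le_div_iff₀ hs0]; nlinarith
  have hr₁0 : 0 < r₁ := by linarith
  set θ := r₁ ^ (1 - α) / (k + s) with hθ
  have hθ0 : 0 < θ := by positivity
  have hθr : θ * (k + s) = r₁ ^ (1 - α) := by rw [hθ]; field_simp
  have hrr : ∀ r : ℝ, 0 < r → r ^ (1 - α) * r ^ α = r := fun r hr => by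
    rw [← Real.rpow_add hr]; simp
  have hy₁ : θ * s * r₁ ^ α = Real.pi := by
    have h1 : θ * (k + s) * r₁ ^ α = r₁ := by rw [hθr, hrr r₁ hr₁0]
    have h2 : r₁ * s = Real.pi * (k + s) := by rw [hr₁]; field_simp
    have h3 : (θ * s * r₁ ^ α) * (k + s) = Real.pi * (k + s) := by
      linear_combination s * h1 + h2
    exact mul_right_cancel₀ (by positivity) h3
  refine ⟨θ, ?_, ?_, ?_⟩
  · rw [hθ, div_le_div_iff₀ two_pos (by positivity)]
    have := Real.one_le_rpow hr₁1 (by linarith : 0 ≤ 1 - α)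
    linarith
  · have h1 : θ ≤ r₁ ^ (1 - α) := div_le_self (by positivity) hks1
    refine h1.trans ?_
    rw [Real.rpow_def_of_pos hr₁0, Real.exp_le_exp]
    have h2 := Real.log_le_self hr₁0.le
    have h3 : r₁ * (1 - α) ≤ Real.pi := by
      rw [hr₁, div_mul_eq_mul_div, div_le_iff₀ hs0]
      have : (k + s) * (1 - α) ≤ s := by nlinarith
      nlinarith
    have h4 : Real.log r₁ * (1 - α) ≤ r₁ * (1 - α) := by
      apply mul_le_mul_of_nonneg_right h2; linarith
    linarith
  · obtain ⟨hi, he⟩ := integral_wrightDensity_eq hα0 hα1 hθ0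
    obtain ⟨hi2, he2⟩ := integral_rpow_mul_exp_neg_quadratic hα0 (mul_pos hθ0 hs0)
    rw [he]
    have hmono := setIntegral_mono_on hi2 hi measurableSet_Ioi ?_
    · rw [he2] at hmono
      calc (Real.pi ^ 2)⁻¹ = Real.pi⁻¹ * (Real.pi * 1)⁻¹ := by rw [mul_one, sq, mul_inv]
        _ ≤ Real.pi⁻¹ * (Real.pi * α)⁻¹ := by gcongr
        _ ≤ _ := by gcongr
    · intro r hr
      have hr0 : (0 : ℝ) < r := hr
      have hra : 0 < r ^ α := by positivity
      have hry : θ * r ^ α * s = θ * s * r ^ α := by ring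
      rw [← hs, hry]
      have hexp : Real.exp (-r) * r⁻¹ * (Real.exp (-(θ * r ^ α) * Real.cos (Real.pi * α)) *
          Real.sin (θ * s * r ^ α)) =
          r⁻¹ * (Real.exp (-r + θ * r ^ α * k) * Real.sin (θ * s * r ^ α)) := by
        rw [Real.exp_add, hk]; ring_nf
      rw [hexp]
      refine mul_le_mul_of_nonneg_left ?_ (by positivity)
      have hsin := quadratic_le_sin (y := θ * s * r ^ α) (by positivity)
      rcases le_total r r₁ with h | h
      · have h1 : r ^ (1 - α) ≤ θ * (k + s) := by
          rw [hθr]; exact Real.rpow_le_rpow hr0.le h (by linarith)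
        have h2 : r ≤ θ * (k + s) * r ^ α := by
          calc r = r ^ (1 - α) * r ^ α := (hrr r hr0).symm
            _ ≤ _ := by gcongr
        have h3 : θ * s * r ^ α ≤ Real.pi := by
          rw [← hy₁]; gcongr
        have h4 : 0 ≤ Real.sin (θ * s * r ^ α) :=
          Real.sin_nonneg_of_nonneg_of_le_pi (by positivity) h3
        calc _ ≤ Real.exp (-(θ * s * r ^ α)) * Real.sin (θ * s * r ^ α) := by gcongr
          _ ≤ _ := by
            gcongr
            linarith
      · have h1 : θ * (k + s) ≤ r ^ (1 - α) := by
          rw [hθr]; exact Real.rpow_le_rpow hr₁0.le h (by linarith)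
        have h2 : θ * (k + s) * r ^ α ≤ r := by
          calc θ * (k + s) * r ^ α ≤ r ^ (1 - α) * r ^ α := by gcongr
            _ = r := hrr r hr0
        have h3 : Real.pi ≤ θ * s * r ^ α := by
          rw [← hy₁]; gcongr
        have h4 : (2 * (θ * s * r ^ α) - (θ * s * r ^ α) ^ 2) / Real.pi ≤ 0 := by
          apply div_nonpos_of_nonpos_of_nonneg _ hpi.le
          nlinarith
        calc _ ≤ Real.exp (-r + θ * r ^ α * k) *
              ((2 * (θ * s * r ^ α) - (θ * s * r ^ α) ^ 2) / Real.pi) := by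
              refine mul_le_mul_of_nonpos_right (Real.exp_le_exp.2 ?_) h4
              linarith
          _ ≤ _ := by gcongr

theorem ofReal_setIntegral_le {f : ℝ → ℝ} {s : Set ℝ} (hf : IntegrableOn f s) :
    ENNReal.ofReal (∫ x in s, f x) ≤ ∫⁻ x in s, ENNReal.ofReal (f x) := by
  rw [integral_eq_lintegral_pos_part_sub_lintegral_neg_part hf]
  refine (ENNReal.ofReal_le_ofReal (sub_le_self _ ENNReal.toReal_nonneg)).trans ?_
  exact ENNReal.ofReal_toReal_le

/-- For `α > 1/2` the bound `|h_α| ≤ 2` near `0` limits the integral over `(0, 1/40)` to `1/20`,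
whereas the integral over some `(0, θ)` with `θ ≤ e^π` is at least `1/π² ≥ 1/10`. -/
theorem wrightMass_uniform {α : ℝ} (hα : 1 / 2 < α) (hα1 : α < 1) :
    WrightMass α (1 / 40) (Real.exp Real.pi) (1 / 20) := by
  have hpi := Real.pi_pos
  have hpi3 := Real.pi_gt_three
  have hα0 : 0 < α := by linarith
  refine ⟨by norm_num, Real.exp_pos _, by norm_num, ?_⟩
  obtain ⟨θ, h1, h2, h3⟩ := exists_integral_wrightDensity_ge hα hα1
  have hi := (hasSum_integral_wrightDensity hα0 hα1 (by linarith : 0 < θ)).1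
  have hi1 : IntervalIntegrable (wrightDensity α) volume 0 (1 / 40) :=
    hi.mono_set (uIcc_subset_uIcc left_mem_uIcc (by rw [uIcc_of_le (by linarith)]; constructor <;> linarith))
  have hi2 : IntervalIntegrable (wrightDensity α) volume (1 / 40) θ :=
    hi.mono_set (uIcc_subset_uIcc (by rw [uIcc_of_le (by linarith)]; constructor <;> linarith) right_mem_uIcc)
  have hadd := intervalIntegral.integral_add_adjacent_intervals hi1 hi2
  have hsmall : ∫ x in (0 : ℝ)..(1 / 40), wrightDensity α x ≤ 1 / 20 := by
    have h := intervalIntegral.norm_integral_le_of_norm_le_const (a := 0) (b := 1 / 40)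
      (f := wrightDensity α) (C := 2) fun x hx => by
        rw [uIoc_of_le (by norm_num)] at hx
        refine (abs_wrightDensity_le hα0 hα1 (by rw [abs_of_pos hx.1]; linarith [hx.2])).trans ?_
        have : α⁻¹ ≤ 2 := by
          rw [inv_le_comm₀ hα0 two_pos]; linarith
        have h4 : (α⁻¹ + 1) / Real.pi ≤ 1 := by rw [div_le_one hpi]; linarith
        linarith
    have := (le_abs_self _).trans h
    norm_num at this
    linarith
  have hbig : (1 : ℝ) / 10 ≤ (Real.pi ^ 2)⁻¹ := by
    rw [one_div]
    apply inv_anti₀ (by positivity)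
    nlinarith [Real.pi_lt_d2]
  have hge : 1 / 20 ≤ ∫ x in Ioc (1 / 40) θ, wrightDensity α x := by
    rw [← intervalIntegral.integral_of_le (by linarith)]
    linarith
  calc ENNReal.ofReal (1 / 20) ≤ ENNReal.ofReal (∫ x in Ioc (1 / 40) θ, wrightDensity α x) :=
        ENNReal.ofReal_le_ofReal hge
    _ ≤ ∫⁻ x in Ioc (1 / 40) θ, ENNReal.ofReal (wrightDensity α x) := ofReal_setIntegral_le hi2.1
    _ ≤ _ := lintegral_mono_set (Ioc_subset_Ioc_right h2)

/-! ### Blow-up from a large lower bound on a parabolic cylinder -/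

theorem ae_lower_iterate {N : ℕ} {α p T a b c τ₀ D R B : ℝ} {μ : Measure (Space N)}
    {u : ℝ × Space N → ℝ≥0∞} (hα : 0 < α) (hα1 : α < 1) (hu : IsSolution α p T μ u)
    (hw : WrightMass α a b c) (hp : 0 ≤ p) (h0 : 0 ≤ τ₀) (hD : 0 < D) (hT : τ₀ + D ≤ T)
    (hR : 0 < R) (hRD : b * D ^ α ≤ R ^ 2) (hB : 0 < B) {e : ℝ} (he : 0 ≤ e)
    (hlow : ∀ᵐ z : ℝ × Space N, z.1 ∈ Ioo (τ₀ + e) (τ₀ + D) → ‖z.2‖ < R → ENNReal.ofReal B ≤ u z)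
    {e' : ℝ} (hee : e < e') :
    ∀ᵐ z : ℝ × Space N, z.1 ∈ Ioo (τ₀ + e') (τ₀ + D) → ‖z.2‖ < R →
      ENNReal.ofReal (α * (D ^ (α - 1) * (a * c * (B ^ p * coneConst N))) * (e' - e)) ≤ u z := by
  have hcone := coneConst_pos N
  have ha := hw.a_pos
  have hb := hw.b_pos
  have hc := hw.c_pos
  have h := hu.duhamel_lower hw hp (by linarith : 0 ≤ τ₀ + e) hT (f := fun _ => B) (R := fun _ => R)
    hlow
  filter_upwards [h] with z hz hz1 hzR
  have hz2 := hz ⟨by linarith [hz1.1], hz1.2⟩ z.1 le_rfl (fun _ => ENNReal.ofReal (coneConst N)) ?_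
  · refine le_trans ?_ hz2
    have h1 : ENNReal.ofReal (D ^ (α - 1) * (a * c * (B ^ p * coneConst N)) * (e' - e)) ≤
        ∫⁻ s in Ioo (τ₀ + e) z.1, ENNReal.ofReal ((z.1 - s) ^ (α - 1)) * (ENNReal.ofReal (a * c) *
          (ENNReal.ofReal B ^ p * ENNReal.ofReal (coneConst N))) := by
      calc _ ≤ ENNReal.ofReal (D ^ (α - 1) * (a * c * (B ^ p * coneConst N))) *
            volume (Ioo (τ₀ + e) z.1) := by
            rw [Real.volume_Ioo, ← ENNReal.ofReal_mul (by positivity)]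
            refine ENNReal.ofReal_le_ofReal (mul_le_mul_of_nonneg_left ?_ (by positivity))
            linarith [hz1.1]
        _ ≤ _ := by
            rw [← setLIntegral_const]
            refine setLIntegral_mono' measurableSet_Ioo fun s hs => ?_
            rw [ENNReal.ofReal_rpow_of_pos hB, ← ENNReal.ofReal_mul (by positivity),
              ← ENNReal.ofReal_mul (by positivity), ← ENNReal.ofReal_mul (by
                have : 0 < z.1 - s := by linarith [hs.2]
                positivity)]
            apply ENNReal.ofReal_le_ofReal
            gcongr ?_ * _
            apply Real.rpow_le_rpow_of_nonpos (by linarith [hs.2]) (by linarith [hs.1, hz1.2])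
            linarith
    rw [mul_assoc, ENNReal.ofReal_mul hα.le]
    gcongr
  · intro s hs θ hθ
    have hs0 : 0 < z.1 - s := by linarith [hs.2]
    have hθ0 : 0 < θ := ha.trans hθ.1
    refine lintegral_heatKernel_self_ball (by positivity) ?_ hR hzR
    have : (z.1 - s) ^ α ≤ D ^ α := by
      apply Real.rpow_le_rpow hs0.le _ hα.le
      linarith [hs.1, hz1.2]
    calc (z.1 - s) ^ α * θ ≤ D ^ α * b := by
          gcongr
          exact hθ.2
      _ ≤ R ^ 2 := by linarith

/-- The threshold in `IsSolution.blow_up`. -/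
def blowConst (N : ℕ) (α a c : ℝ) : ℝ :=
  4 * 2 ^ ((N : ℝ) / 2) / (α * (a * c * coneConst N))

/-- A solution which is larger than the blow-up threshold on a parabolic cylinder cannot exist up
to the final time of the cylinder. -/
theorem IsSolution.blow_up {N : ℕ} (hN : 1 ≤ N) {α T a b c τ₀ D R B : ℝ} {μ : Measure (Space N)}
    {u : ℝ × Space N → ℝ≥0∞} (hα : 0 < α) (hα1 : α < 1) (hu : IsSolution α (fujita N) T μ u)
    (hw : WrightMass α a b c) (h0 : 0 ≤ τ₀) (hD : 0 < D) (hT : τ₀ + D ≤ T)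
    (hR : 0 < R) (hRD : b * D ^ α ≤ R ^ 2) (hB : 0 < B)
    (hlow : ∀ᵐ z : ℝ × Space N, z.1 ∈ Ioo τ₀ (τ₀ + D) → ‖z.2‖ < R → ENNReal.ofReal B ≤ u z) :
    B ^ (2 / (N : ℝ)) * D ^ α < blowConst N α a c := by
  have hN0 : (0 : ℝ) < N := by exact_mod_cast hN
  have hcone := coneConst_pos N
  have ha := hw.a_pos
  have hc := hw.c_pos
  by_contra! hcon
  -- Since `Q^{2/N} = 2`, the gain `(B Q^k)^{2/N}` grows like `2^k` and exactly offsets the time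
  -- increments `D 2^{-k} / 4`. All bounds `B Q^k` then hold on the second half of the time
  -- interval.
  set Q : ℝ := 2 ^ ((N : ℝ) / 2) with hQ
  have hQ0 : 0 < Q := by positivity
  have hQ1 : 1 < Q := Real.one_lt_rpow one_lt_two (by positivity)
  have hQp : Q ^ (2 / (N : ℝ)) = 2 := by
    rw [hQ, ← Real.rpow_mul two_pos.le]
    have : (N : ℝ) / 2 * (2 / N) = 1 := by field_simp
    rw [this, Real.rpow_one]
  have hp : 0 ≤ fujita N := by unfold fujita; positivity
  have hmain : 4 * Q ≤ α * (a * c * coneConst N) * (B ^ (2 / (N : ℝ)) * D ^ α) := by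
    rw [blowConst, div_le_iff₀ (by positivity)] at hcon
    linarith
  have key : ∀ k : ℕ, ∀ᵐ z : ℝ × Space N,
      z.1 ∈ Ioo (τ₀ + D * (1 - (1 / 2) ^ k) / 2) (τ₀ + D) → ‖z.2‖ < R →
        ENNReal.ofReal (B * Q ^ k) ≤ u z := by
    intro k
    induction k with
    | zero => simpa using hlow
    | succ k ih =>
      have hk : (0 : ℝ) < (1 / 2) ^ k := by positivity
      have hk1 : (1 / 2 : ℝ) ^ k ≤ 1 := pow_le_one₀ (by norm_num) (by norm_num)
      have hstep := ae_lower_iterate hα hα1 hu hw hp h0 hD hT hR hRD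
        (by positivity : 0 < B * Q ^ k) (e := D * (1 - (1 / 2) ^ k) / 2)
        (by have := sub_nonneg.2 hk1; positivity) ih
        (e' := D * (1 - (1 / 2) ^ (k + 1)) / 2) (by rw [pow_succ]; nlinarith)
      filter_upwards [hstep] with z hz hz1 hz2
      refine le_trans (ENNReal.ofReal_le_ofReal ?_) (hz hz1 hz2)
      have e1 : (B * Q ^ k) ^ fujita N = B * Q ^ k * (B ^ (2 / (N : ℝ)) * 2 ^ k) := by
        rw [fujita, Real.rpow_add (by positivity), Real.rpow_one, Real.mul_rpow hB.le (by positivity),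
          ← Real.rpow_natCast Q k, ← Real.rpow_mul hQ0.le, mul_comm (k : ℝ), Real.rpow_mul hQ0.le, hQp,
          Real.rpow_natCast, Real.rpow_natCast]
      have e2 : D * (1 - (1 / 2) ^ (k + 1)) / 2 - D * (1 - (1 / 2) ^ k) / 2 = D * (1 / 2) ^ k / 4 := by
        rw [pow_succ]; ring
      have e3 : D ^ (α - 1) * D = D ^ α := by
        rw [← Real.rpow_add_one hD.ne']; ring_nf
      have e4 : (2 : ℝ) ^ k * (1 / 2) ^ k = 1 := by rw [← mul_pow]; norm_num
      rw [e1, e2]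
      calc B * Q ^ (k + 1) = B * Q ^ k * (4 * Q) / 4 := by ring
        _ ≤ B * Q ^ k * (α * (a * c * coneConst N) * (B ^ (2 / (N : ℝ)) * D ^ α)) / 4 := by gcongr
        _ = _ := by
          rw [← e3]
          linear_combination (-(B * Q ^ k * (α * (a * c * coneConst N) *
            (B ^ (2 / (N : ℝ)) * (D ^ (α - 1) * D))) / 4)) * e4
  have hall := ae_all_iff.2 key
  have hfalse : ∀ᵐ z : ℝ × Space N, z ∉ Ioo (τ₀ + D / 2) (τ₀ + D) ×ˢ Metric.ball (0 : Space N) R := by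
    filter_upwards [hall, hu.ae_eqn] with z hz hze hmem
    have hz1 : z.1 ∈ Ioo (τ₀ + D / 2) (τ₀ + D) := hmem.1
    have hz2 : ‖z.2‖ < R := by simpa using hmem.2
    have hfin := (hze ⟨by linarith [hz1.1], by linarith [hz1.2]⟩).1
    obtain ⟨k, hk⟩ := ((tendsto_pow_atTop_atTop_of_one_lt hQ1).const_mul_atTop hB).eventually_gt_atTop
      (u z).toReal |>.exists
    have hk1 : (0 : ℝ) < (1 / 2) ^ k := by positivity
    have hle := hz k ⟨by nlinarith [hz1.1], hz1.2⟩ hz2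
    exact absurd ((ENNReal.ofReal_le_iff_le_toReal hfin.ne).1 hle) (not_le.2 hk)
  have hnull : volume (Ioo (τ₀ + D / 2) (τ₀ + D) ×ˢ Metric.ball (0 : Space N) R) = 0 := by
    exact measure_eq_zero_iff_ae_notMem.2 hfalse
  rw [Measure.volume_eq_prod, Measure.prod_prod, mul_eq_zero] at hnull
  rcases hnull with h | h
  · rw [Real.volume_Ioo, ENNReal.ofReal_eq_zero] at h
    linarith
  · exact (Metric.measure_ball_pos volume (0 : Space N) hR).ne' h

/-! ### Self-similar lower bounds and their iteration -/

/-- The constant in the parabolic lower bound of the heat kernel on balls. -/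
def parConst (N : ℕ) (a b : ℝ) : ℝ :=
  ((4 * Real.pi * b) ^ ((N : ℝ) / 2))⁻¹ * Real.exp (-2 / a) * unitBallVolume N

theorem parConst_pos (N : ℕ) {a b : ℝ} (hb : 0 < b) : 0 < parConst N a b := by
  have := unitBallVolume_pos N
  have := Real.pi_pos
  unfold parConst
  positivity

theorem lintegral_heatKernel_parabolic {N : ℕ} {α a b t τ R : ℝ} {x : Space N} (hα : 0 < α)
    (hα1 : α < 1) (ha : 0 < a) (hb : 0 < b) (ht : 0 < t) (h1 : (t / 2) ^ α * a ≤ τ)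
    (h2 : τ ≤ t ^ α * b) (hx : ‖x‖ ≤ t ^ (α / 2)) (hR : 0 < R) (hRt : R ≤ t ^ (α / 2)) :
    ENNReal.ofReal (parConst N a b * t ^ (-(α * N / 2)) * R ^ N) ≤
      ∫⁻ y in Metric.ball 0 R, ENNReal.ofReal (heatKernel N τ (x - y)) := by
  have hω := unitBallVolume_pos N
  have hpi := Real.pi_pos
  have hlo : 0 < (t / 2) ^ α * a := by positivity
  refine le_trans (ENNReal.ofReal_le_ofReal ?_)
    (lintegral_heatKernel_ball_lower hlo h1 h2 hR hx)
  have e1 : (4 * Real.pi * (t ^ α * b)) ^ ((N : ℝ) / 2) =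
      (4 * Real.pi * b) ^ ((N : ℝ) / 2) * t ^ (α * N / 2) := by
    rw [show 4 * Real.pi * (t ^ α * b) = 4 * Real.pi * b * t ^ α by ring,
      Real.mul_rpow (by positivity) (by positivity), ← Real.rpow_mul ht.le, mul_div_assoc]
  have e2 : Real.exp (-2 / a) ≤ Real.exp (-(t ^ (α / 2) + R) ^ 2 / (4 * ((t / 2) ^ α * a))) := by
    rw [Real.exp_le_exp, neg_div, neg_div, neg_le_neg_iff, div_le_div_iff₀ (by positivity) ha]
    have e3 : (t ^ (α / 2)) ^ 2 = t ^ α := by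
      rw [← Real.rpow_natCast, ← Real.rpow_mul ht.le]; congr 1; push_cast; ring
    have e4 : (t ^ (α / 2) + R) ^ 2 ≤ 4 * t ^ α := by
      rw [← e3]
      have : t ^ (α / 2) + R ≤ 2 * t ^ (α / 2) := by linarith
      calc _ ≤ (2 * t ^ (α / 2)) ^ 2 := by gcongr
        _ = _ := by ring
    have e5 : t ^ α ≤ 2 * (t / 2) ^ α := by
      rw [Real.div_rpow ht.le two_pos.le]
      have h3 : (2 : ℝ) ^ α ≤ 2 := by
        simpa using Real.rpow_le_rpow_of_exponent_le one_le_two hα1.le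
      have h4 : (0 : ℝ) < 2 ^ α := by positivity
      have h5 : 0 < t ^ α := by positivity
      rw [mul_div_assoc', le_div_iff₀ h4]
      nlinarith
    nlinarith
  rw [e1, parConst, Real.rpow_neg ht.le]
  calc _ = ((4 * Real.pi * b) ^ ((N : ℝ) / 2) * t ^ (α * N / 2))⁻¹ * Real.exp (-2 / a) *
        (R ^ N * unitBallVolume N) := by rw [mul_inv]; ring
    _ ≤ _ := by gcongr

/-- `u` dominates the self-similar profile `A t^{-αN/2}` inside the parabola `|x| < t^{α/2}`, for
times in `(t₀, T)`. -/
def ParabolicLower {N : ℕ} (α T A t₀ : ℝ) (u : ℝ × Space N → ℝ≥0∞) : Prop :=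
  ∀ᵐ z : ℝ × Space N, z.1 ∈ Ioo t₀ T → ‖z.2‖ < z.1 ^ (α / 2) →
    ENNReal.ofReal (A * z.1 ^ (-(α * N / 2))) ≤ u z

theorem ParabolicLower.mono {N : ℕ} {α T A A' t₀ : ℝ} {u : ℝ × Space N → ℝ≥0∞}
    (h : ParabolicLower α T A t₀ u) (hA : A' ≤ A) (ht₀ : 0 < t₀) : ParabolicLower α T A' t₀ u := by
  filter_upwards [h] with z hz hz1 hz2
  have : 0 < z.1 := ht₀.trans hz1.1
  refine le_trans (ENNReal.ofReal_le_ofReal ?_) (hz hz1 hz2)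
  gcongr

/-- The delay factor makes `t₀^{1-α}` at most `t^{1-α} / 4`, while `(t/2)^{1-α}` is at least
`t^{1-α} / 2`; a quarter survives. -/
theorem lintegral_rpow_neg_ge {α t₀ t M : ℝ} (hα : 0 < α) (hα1 : α < 1) (ht₀ : 0 < t₀)
    (hM : 0 ≤ M) (ht : 4 ^ (1 / (1 - α)) * t₀ ≤ t) :
    ENNReal.ofReal (M * (t ^ (1 - α) / (4 * (1 - α)))) ≤
      ∫⁻ s in Ioo t₀ (t / 2), ENNReal.ofReal (M * s ^ (-α)) := by
  have h1α : 0 < 1 - α := by linarith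
  have hΛ : (4 : ℝ) ≤ 4 ^ (1 / (1 - α)) :=
    Real.self_le_rpow_of_one_le (by norm_num) (by rw [le_div_iff₀ h1α]; linarith)
  have htt : t₀ ≤ t / 2 := by nlinarith
  have ht0 : 0 < t := by linarith
  have hi : IntervalIntegrable (fun s : ℝ => M * s ^ (-α)) volume t₀ (t / 2) :=
    (intervalIntegral.intervalIntegrable_rpow' (by linarith)).const_mul M
  rw [restrict_Ioo_eq_restrict_Ioc, ← ofReal_integral_eq_lintegral_ofReal hi.1 (by
    filter_upwards [ae_restrict_mem measurableSet_Ioc] with s hs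
    have : 0 < s := ht₀.trans hs.1
    exact mul_nonneg hM (by positivity)), ← intervalIntegral.integral_of_le htt,
    intervalIntegral.integral_const_mul, integral_rpow (Or.inl (by linarith))]
  refine ENNReal.ofReal_le_ofReal (mul_le_mul_of_nonneg_left ?_ hM)
  rw [neg_add_eq_sub, div_le_div_iff₀ (by positivity) h1α]
  have h1 : 4 * t₀ ^ (1 - α) ≤ t ^ (1 - α) := by
    calc 4 * t₀ ^ (1 - α) = (4 ^ (1 / (1 - α)) * t₀) ^ (1 - α) := by
          rw [Real.mul_rpow (by positivity) ht₀.le, ← Real.rpow_mul (by norm_num), one_div,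
            inv_mul_cancel₀ h1α.ne', Real.rpow_one]
      _ ≤ _ := by gcongr
  have h2 : t ^ (1 - α) ≤ 2 * (t / 2) ^ (1 - α) := by
    have h3 : (2 : ℝ) ^ (1 - α) ≤ 2 := by
      simpa using Real.rpow_le_rpow_of_exponent_le one_le_two (by linarith : 1 - α ≤ 1)
    calc t ^ (1 - α) = 2 ^ (1 - α) * (t / 2) ^ (1 - α) := by
          rw [← Real.mul_rpow two_pos.le (by positivity)]; congr 1; ring
      _ ≤ _ := by gcongr
  nlinarith

theorem ParabolicLower.step {N : ℕ} (hN : 1 ≤ N) {α T a b c A t₀ : ℝ} {μ : Measure (Space N)}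
    {u : ℝ × Space N → ℝ≥0∞} (hα : 0 < α) (hα1 : α < 1) (hu : IsSolution α (fujita N) T μ u)
    (hw : WrightMass α a b c) (ht₀ : 0 < t₀) (hA : 0 < A) (h : ParabolicLower α T A t₀ u) :
    ParabolicLower α T (α * (a * c * parConst N a b) / (4 * (1 - α)) * A ^ fujita N)
      (4 ^ (1 / (1 - α)) * t₀) u := by
  have hN0 : (0 : ℝ) < N := by exact_mod_cast hN
  have ha := hw.a_pos
  have hb := hw.b_pos
  have hc := hw.c_pos
  have hpar : 0 < parConst N a b := parConst_pos N hb
  have hp : 0 ≤ fujita N := by unfold fujita; positivity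
  have h1α : 0 < 1 - α := by linarith
  have hd := hu.duhamel_lower hw hp ht₀.le le_rfl (f := fun s => A * s ^ (-(α * N / 2)))
    (R := fun s => s ^ (α / 2)) h
  filter_upwards [hd] with z hz hz1 hz2
  set t := z.1 with ht
  have hΛ : (1 : ℝ) ≤ 4 ^ (1 / (1 - α)) := Real.one_le_rpow (by norm_num) (by positivity)
  have htt₀ : t₀ < t := by nlinarith [hz1.1]
  have ht0 : 0 < t := ht₀.trans htt₀
  have hz3 := hz ⟨htt₀, hz1.2⟩ (t / 2) (by linarith)
    (fun s => ENNReal.ofReal (parConst N a b * t ^ (-(α * N / 2)) * (s ^ (α / 2)) ^ N)) ?_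
  · refine le_trans ?_ hz3
    have e0 : α * (a * c * parConst N a b) / (4 * (1 - α)) * A ^ fujita N * t ^ (-(α * N / 2)) =
        α * ((t ^ (α - 1) * (a * c * (A ^ fujita N * (parConst N a b * t ^ (-(α * N / 2)))))) *
          (t ^ (1 - α) / (4 * (1 - α)))) := by
      have : t ^ (α - 1) * t ^ (1 - α) = 1 := by rw [← Real.rpow_add ht0]; simp
      linear_combination (-(α * (a * c * parConst N a b) / (4 * (1 - α)) * A ^ fujita N *
        t ^ (-(α * N / 2)))) * this
    rw [e0, ENNReal.ofReal_mul hα.le]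
    gcongr
    refine (lintegral_rpow_neg_ge hα hα1 ht₀ (by positivity) hz1.1.le).trans ?_
    refine setLIntegral_mono' measurableSet_Ioo fun s hs => ?_
    have hs0 : 0 < s := ht₀.trans hs.1
    have hts : 0 < t - s := by linarith [hs.2]
    rw [ENNReal.ofReal_rpow_of_pos (by positivity), ← ENNReal.ofReal_mul (by positivity),
      ← ENNReal.ofReal_mul (by positivity), ← ENNReal.ofReal_mul (by positivity)]
    apply ENNReal.ofReal_le_ofReal
    -- Criticality: `-(αN/2)(1 + 2/N) + αN/2 = -α`, with no other power of `s` left.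
    have e1 : (A * s ^ (-(α * N / 2))) ^ fujita N * (s ^ (α / 2)) ^ N = A ^ fujita N * s ^ (-α) := by
      rw [Real.mul_rpow hA.le (by positivity), ← Real.rpow_mul hs0.le, ← Real.rpow_natCast,
        ← Real.rpow_mul hs0.le, mul_assoc, ← Real.rpow_add hs0, fujita]
      congr 2
      field_simp
      ring
    have e2 : t ^ (α - 1) ≤ (t - s) ^ (α - 1) :=
      Real.rpow_le_rpow_of_nonpos hts (by linarith) (by linarith)
    calc _ = t ^ (α - 1) * (a * c * ((A ^ fujita N * s ^ (-α)) *
          (parConst N a b * t ^ (-(α * N / 2))))) := by ring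
      _ = t ^ (α - 1) * (a * c * ((A * s ^ (-(α * N / 2))) ^ fujita N *
          (parConst N a b * t ^ (-(α * N / 2)) * (s ^ (α / 2)) ^ N))) := by rw [← e1]; ring
      _ ≤ _ := by gcongr
  · intro s hs θ hθ
    have hs0 : 0 < s := ht₀.trans hs.1
    have hts : 0 < t - s := by linarith [hs.2]
    refine lintegral_heatKernel_parabolic hα hα1 ha hb ht0 ?_ ?_ hz2.le (by positivity) ?_
    · have h3 : (t / 2) ^ α ≤ (t - s) ^ α :=
        Real.rpow_le_rpow (by positivity) (by linarith [hs.2]) hα.le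
      have := hθ.1.le
      gcongr
    · have h3 : (t - s) ^ α ≤ t ^ α := Real.rpow_le_rpow hts.le (by linarith) hα.le
      have := hθ.2
      have : 0 < θ := ha.trans hθ.1
      gcongr
    · exact Real.rpow_le_rpow hs0.le (by linarith [hs.2]) (by positivity)

theorem ParabolicLower.iterate {N : ℕ} (hN : 1 ≤ N) {α T a b c A t₀ : ℝ} {μ : Measure (Space N)}
    {u : ℝ × Space N → ℝ≥0∞} (hα : 0 < α) (hα1 : α < 1) (hu : IsSolution α (fujita N) T μ u)
    (hw : WrightMass α a b c) (ht₀ : 0 < t₀) (hA : 0 < A) (h : ParabolicLower α T A t₀ u)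
    (hlarge : 8 * (1 - α) ≤ α * (a * c * parConst N a b) * A ^ (2 / (N : ℝ))) (k : ℕ) :
    ParabolicLower α T (2 ^ k * A) ((4 ^ (1 / (1 - α))) ^ k * t₀) u := by
  have ha := hw.a_pos
  have hc := hw.c_pos
  have hpar : 0 < parConst N a b := parConst_pos N hw.b_pos
  have h1α : 0 < 1 - α := by linarith
  induction k with
  | zero => simpa using h
  | succ k ih =>
    have hs := ih.step hN hα hα1 hu hw (by positivity) (by positivity)
    rw [← mul_assoc ((4 : ℝ) ^ (1 / (1 - α))), ← pow_succ'] at hs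
    refine hs.mono ?_ (by positivity)
    have h1 : A ^ (2 / (N : ℝ)) ≤ (2 ^ k * A) ^ (2 / (N : ℝ)) := by
      have : A ≤ 2 ^ k * A := le_mul_of_one_le_left hA.le (one_le_pow₀ one_le_two)
      gcongr
    have h2 : 2 ≤ α * (a * c * parConst N a b) / (4 * (1 - α)) * (2 ^ k * A) ^ (2 / (N : ℝ)) := by
      rw [div_mul_eq_mul_div, le_div_iff₀ (by positivity)]
      calc 2 * (4 * (1 - α)) = 8 * (1 - α) := by ring
        _ ≤ _ := hlarge
        _ ≤ _ := by gcongr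
    rw [fujita, Real.rpow_add (by positivity), Real.rpow_one, pow_succ']
    have h3 : 0 < 2 ^ k * A := by positivity
    nlinarith

/-- A large self-similar lower bound is incompatible with existence on a longer time interval. -/
theorem ParabolicLower.lt_blowConst {N : ℕ} (hN : 1 ≤ N) {α T a b c A t₀ : ℝ} {μ : Measure (Space N)}
    {u : ℝ × Space N → ℝ≥0∞} (hα : 0 < α) (hα1 : α < 1) (hu : IsSolution α (fujita N) T μ u)
    (hw : WrightMass α a b c) (ht₀ : 0 < t₀) (hA : 0 < A) (h : ParabolicLower α T A t₀ u)
    (hT : 2 * t₀ ≤ T) {δ : ℝ} (hδ : 0 < δ) (hδ1 : δ ≤ 1) (hbδ : b * δ ^ α ≤ 1) :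
    A ^ (2 / (N : ℝ)) * (2 ^ (-α) * δ ^ α) < blowConst N α a c := by
  have hN0 : (0 : ℝ) < N := by exact_mod_cast hN
  -- On this cylinder `t < 2 t₀`, and the quantity `B^{2/N} D^α` does not depend on `t₀`.
  have h1 := hu.blow_up hN hα hα1 hw (τ₀ := t₀) (D := δ * t₀) (R := t₀ ^ (α / 2))
    (B := A * (2 * t₀) ^ (-(α * N / 2))) ht₀.le (by positivity) (by nlinarith) (by positivity)
    ?_ (by positivity) ?_
  · refine lt_of_eq_of_lt ?_ h1
    rw [Real.mul_rpow hA.le (by positivity), ← Real.rpow_mul (by positivity),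
      Real.mul_rpow hδ.le ht₀.le, Real.mul_rpow two_pos.le ht₀.le]
    have e : -(α * N / 2) * (2 / N) = -α := by field_simp
    have e1 : t₀ ^ (-α) * t₀ ^ α = 1 := by rw [← Real.rpow_add ht₀]; simp
    rw [e]
    linear_combination (-(A ^ (2 / (N : ℝ)) * (2 ^ (-α) * δ ^ α))) * e1
  · have e3 : (t₀ ^ (α / 2)) ^ 2 = t₀ ^ α := by
      rw [← Real.rpow_natCast, ← Real.rpow_mul ht₀.le]; congr 1; push_cast; ring
    rw [e3, Real.mul_rpow hδ.le ht₀.le, ← mul_assoc]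
    exact mul_le_of_le_one_left (by positivity) hbδ
  · filter_upwards [h] with z hz hz1 hz2
    have hz0 : 0 < z.1 := ht₀.trans hz1.1
    have h3 : z.1 < 2 * t₀ := by nlinarith [hz1.2]
    refine le_trans (ENNReal.ofReal_le_ofReal ?_) (hz ⟨hz1.1, h3.trans_le hT⟩ (hz2.trans_le ?_))
    · gcongr ?_ * ?_
      exact Real.rpow_le_rpow_of_nonpos hz0 h3.le (neg_nonpos.2 (by positivity))
    · exact Real.rpow_le_rpow ht₀.le hz1.1.le (by positivity)

/-! ### The initial data -/

theorem radius_pos (N : ℕ) {j : ℕ} (hj : 1 ≤ j) : 0 < radius N j := by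
  have := unitBallVolume_pos N
  unfold radius
  positivity

theorem radius_rpow (N j : ℕ) (q : ℝ) :
    radius N j ^ q = (j : ℝ) ^ (-(q / N)) * unitBallVolume N ^ (-(q / N)) := by
  have := unitBallVolume_pos N
  rw [radius, ← Real.rpow_mul (by positivity), Real.mul_rpow (by positivity) this.le]
  congr 2 <;> ring

theorem mul_radius_pow {N : ℕ} (hN : 1 ≤ N) {j : ℕ} (hj : 1 ≤ j) :
    (j : ℝ) * radius N j ^ N = (unitBallVolume N)⁻¹ := by
  have hj0 : (0 : ℝ) < j := by exact_mod_cast hj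
  have hN0 : (0 : ℝ) < N := by exact_mod_cast hN
  rw [← Real.rpow_natCast, radius_rpow, div_self hN0.ne', Real.rpow_neg_one, Real.rpow_neg_one]
  field_simp

theorem heat_initialDatum_lower {N : ℕ} {κ τ : ℝ} {j : ℕ} {x : Space N} :
    ENNReal.ofReal (κ * j) * ∫⁻ y in Metric.ball 0 (radius N j),
      ENNReal.ofReal (heatKernel N τ (x - y)) ≤ heat τ (initialDatum N κ j) x := by
  refine heat_withDensity_lower (ae_of_all _ fun y hy => ?_)
  rw [psi, indicator_of_mem (by simpa using hy)]

theorem parabolicLower_initial {N : ℕ} (hN : 1 ≤ N) {α T a b c κ : ℝ} {j : ℕ} (hj : 1 ≤ j)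
    {u : ℝ × Space N → ℝ≥0∞} (hα : 0 < α) (hα1 : α < 1) (hκ : 0 < κ)
    (hu : IsSolution α (fujita N) T (initialDatum N κ j) u) (hw : WrightMass α a b c) :
    ParabolicLower α T (c * κ * parConst N a b * (unitBallVolume N)⁻¹) (radius N j ^ (2 / α)) u := by
  have ha := hw.a_pos
  have hb := hw.b_pos
  have hc := hw.c_pos
  have hρ := radius_pos N hj
  have hpar : 0 < parConst N a b := parConst_pos N hb
  filter_upwards [hu.ae_eqn] with z hz hz1 hz2
  have ht : 0 < z.1 := lt_trans (by positivity) hz1.1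
  refine le_trans ?_ (hz ⟨ht, hz1.2.le⟩).2.1
  have hρt : radius N j ≤ z.1 ^ (α / 2) := by
    calc radius N j = (radius N j ^ (2 / α)) ^ (α / 2) := by
          rw [← Real.rpow_mul hρ.le]
          have : 2 / α * (α / 2) = 1 := by field_simp
          rw [this, Real.rpow_one]
      _ ≤ _ := Real.rpow_le_rpow (by positivity) hz1.1.le (by positivity)
  refine le_trans (le_of_eq ?_) (opP_lower (L := ENNReal.ofReal (κ * j) * ENNReal.ofReal
    (parConst N a b * z.1 ^ (-(α * N / 2)) * radius N j ^ N)) hw fun θ hθ => ?_)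
  · rw [← ENNReal.ofReal_mul (by positivity), ← ENNReal.ofReal_mul hc.le, ← mul_radius_pow hN hj]
    congr 1
    ring
  · refine le_trans ?_ heat_initialDatum_lower
    gcongr
    refine lintegral_heatKernel_parabolic hα hα1 ha hb ht ?_ ?_ hz2.le hρ hρt
    · have h3 : (z.1 / 2) ^ α ≤ z.1 ^ α :=
        Real.rpow_le_rpow (by positivity) (by linarith) hα.le
      have := hθ.1.le
      gcongr
    · have := hθ.2
      gcongr

theorem lifespan_le {N : ℕ} {α p X : ℝ} {μ : Measure (Space N)}
    (h : ∀ T u, IsSolution α p T μ u → T ≤ X) : lifespan α p μ ≤ ENNReal.ofReal X := by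
  refine sSup_le ?_
  rintro τ ⟨T, -, rfl, u, hu⟩
  exact ENNReal.ofReal_le_ofReal (h T u hu.1)

/-! ### Life span estimates -/

/-- The order of quantifiers matters: `A` depends on `α₀, a, b, c` but not on `α`, so uniform mass
yields a uniform multiple of `(1 - α)^{N/2}`. -/
theorem exists_lifespan_bound_of_mass {N : ℕ} (hN : 1 ≤ N) {α₀ a b c : ℝ} (hα₀ : 0 < α₀)
    (ha : 0 < a) (hb : 0 < b) (hc : 0 < c) :
    ∃ A : ℝ, 0 < A ∧ ∀ α : ℝ, α₀ ≤ α → α < 1 → WrightMass α a b c →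
      ∀ κ : ℝ, A * (1 - α) ^ ((N : ℝ) / 2) < κ → ∃ C : ℝ, 0 < C ∧ ∀ j : ℕ, 1 ≤ j →
        lifespan α (fujita N) (initialDatum N κ j) ≤
          ENNReal.ofReal (C * (j : ℝ) ^ (-(2 / (α * (N : ℝ))))) := by
  have hN0 : (0 : ℝ) < N := by exact_mod_cast hN
  have hω := unitBallVolume_pos N
  have hpar : 0 < parConst N a b := parConst_pos N hb
  set E := 8 / (α₀ * (a * c * parConst N a b)) with hE
  have hE0 : 0 < E := by positivity
  refine ⟨unitBallVolume N / (c * parConst N a b) * E ^ ((N : ℝ) / 2), by positivity, ?_⟩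
  intro α hα₀α hα1 hw κ hκ
  have hα : 0 < α := hα₀.trans_le hα₀α
  have h1α : 0 < 1 - α := by linarith
  have hκ0 : 0 < κ := lt_trans (by positivity) hκ
  set A₀ := c * κ * parConst N a b * (unitBallVolume N)⁻¹ with hA₀
  have hA₀0 : 0 < A₀ := by positivity
  have h1 : (E * (1 - α)) ^ ((N : ℝ) / 2) ≤ A₀ := by
    rw [Real.mul_rpow hE0.le h1α.le, hA₀, ← div_eq_mul_inv, le_div_iff₀ hω]
    rw [div_mul_eq_mul_div, div_mul_eq_mul_div, div_lt_iff₀ (by positivity)] at hκ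
    linarith
  have h2 : E * (1 - α) ≤ A₀ ^ (2 / (N : ℝ)) := by
    calc E * (1 - α) = ((E * (1 - α)) ^ ((N : ℝ) / 2)) ^ (2 / (N : ℝ)) := by
          rw [← Real.rpow_mul (by positivity)]
          have : (N : ℝ) / 2 * (2 / N) = 1 := by field_simp
          rw [this, Real.rpow_one]
      _ ≤ _ := by gcongr
  have hlarge : 8 * (1 - α) ≤ α * (a * c * parConst N a b) * A₀ ^ (2 / (N : ℝ)) := by
    calc 8 * (1 - α) = α₀ * (a * c * parConst N a b) * (E * (1 - α)) := by
          rw [hE]; field_simp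
      _ ≤ _ := by gcongr
  obtain ⟨δ, hδ, hδ1, hbδ⟩ : ∃ δ : ℝ, 0 < δ ∧ δ ≤ 1 ∧ b * δ ^ α ≤ 1 := by
    refine ⟨min 1 (b⁻¹ ^ (1 / α)), by positivity, min_le_left _ _, ?_⟩
    calc b * min 1 (b⁻¹ ^ (1 / α)) ^ α ≤ b * (b⁻¹ ^ (1 / α)) ^ α := by
          gcongr
          exact min_le_right _ _
      _ = 1 := by
          rw [← Real.rpow_mul (by positivity), one_div, inv_mul_cancel₀ hα.ne', Real.rpow_one,
            mul_inv_cancel₀ hb.ne']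
  -- Enough doublings to reach the blow-up threshold; `k` is fixed before `j`.
  obtain ⟨k, hk⟩ : ∃ k : ℕ, blowConst N α a c ≤
      (2 ^ k * A₀) ^ (2 / (N : ℝ)) * (2 ^ (-α) * δ ^ α) := by
    have h3 : Tendsto (fun k : ℕ => (2 : ℝ) ^ k * A₀) atTop atTop :=
      (tendsto_pow_atTop_atTop_of_one_lt one_lt_two).atTop_mul_const hA₀0
    have h4 := ((tendsto_rpow_atTop (by positivity : 0 < 2 / (N : ℝ))).comp h3).atTop_mul_const
      (by positivity : 0 < 2 ^ (-α) * δ ^ α)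
    exact (h4.eventually_ge_atTop _).exists
  set Λ : ℝ := 4 ^ (1 / (1 - α)) with hΛ
  refine ⟨2 * Λ ^ k * unitBallVolume N ^ (-(2 / (α * N))), by positivity, fun j hj => ?_⟩
  refine lifespan_le fun T u hu => ?_
  by_contra! hT
  have hρ := radius_pos N hj
  have hρe : radius N j ^ (2 / α) =
      (j : ℝ) ^ (-(2 / (α * N))) * unitBallVolume N ^ (-(2 / (α * N))) := by
    rw [radius_rpow, div_div]
  have hit := (parabolicLower_initial hN hj hα hα1 hκ0 hu hw).iterate hN hα hα1 hu hw
    (by positivity) hA₀0 hlarge k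
  have := hit.lt_blowConst hN hα hα1 hu hw (by positivity) (by positivity)
    (by rw [hρe]; linarith) hδ hδ1 hbδ
  linarith

theorem exists_lifespan_bound_large {N : ℕ} (hN : 1 ≤ N) {α a b c : ℝ} (hα : 0 < α) (hα1 : α < 1)
    (hw : WrightMass α a b c) :
    ∃ K C : ℝ, 0 < K ∧ 0 < C ∧ ∀ κ : ℝ, K < κ → ∀ j : ℕ, 1 ≤ j →
      lifespan α (fujita N) (initialDatum N κ j) ≤
        ENNReal.ofReal (C * κ ^ (-(2 / (α * (N : ℝ)))) * (j : ℝ) ^ (-(2 / (α * (N : ℝ))))) := by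
  have hN0 : (0 : ℝ) < N := by exact_mod_cast hN
  have hω := unitBallVolume_pos N
  have ha := hw.a_pos
  have hb := hw.b_pos
  have hc := hw.c_pos
  have hcone := coneConst_pos N
  have hblow : 0 < blowConst N α a c := by unfold blowConst; positivity
  set M := blowConst N α a c / (c * coneConst N) ^ (2 / (N : ℝ)) with hM
  have hM0 : 0 < M := by positivity
  have hCα : (M ^ (1 / α)) ^ α = M := by
    rw [← Real.rpow_mul hM0.le, one_div, inv_mul_cancel₀ hα.ne', Real.rpow_one]
  -- `M` is chosen so that `D` attains the blow-up threshold exactly for `B = c κ j · coneConst N`;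
  -- the value of `K` ensures `b D^α ≤ r_j²`, so that the heat flow has not yet left the ball.
  refine ⟨unitBallVolume N * (b * M) ^ ((N : ℝ) / 2), M ^ (1 / α), by positivity, by positivity,
    fun κ hκ j hj => lifespan_le fun T u hu => ?_⟩
  have hj0 : (0 : ℝ) < j := by exact_mod_cast hj
  have hκ0 : 0 < κ := lt_trans (by positivity) hκ
  have hρ := radius_pos N hj
  by_contra! hT
  set D := M ^ (1 / α) * κ ^ (-(2 / (α * (N : ℝ)))) * (j : ℝ) ^ (-(2 / (α * (N : ℝ)))) with hD
  have hD0 : 0 < D := by positivity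
  have hexp : -(2 / (α * (N : ℝ))) * α = -(2 / (N : ℝ)) := by field_simp
  have hDα : D ^ α = M * κ ^ (-(2 / (N : ℝ))) * (j : ℝ) ^ (-(2 / (N : ℝ))) := by
    rw [hD, Real.mul_rpow (by positivity) (by positivity), Real.mul_rpow (by positivity)
      (by positivity), hCα, ← Real.rpow_mul hκ0.le, ← Real.rpow_mul hj0.le, hexp]
  have hRD : b * D ^ α ≤ radius N j ^ 2 := by
    have h1 : (unitBallVolume N) ^ (2 / (N : ℝ)) * (b * M) ≤ κ ^ (2 / (N : ℝ)) := by
      calc (unitBallVolume N) ^ (2 / (N : ℝ)) * (b * M)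
          = (unitBallVolume N * (b * M) ^ ((N : ℝ) / 2)) ^ (2 / (N : ℝ)) := by
            rw [Real.mul_rpow hω.le (by positivity), ← Real.rpow_mul (by positivity)]
            have : (N : ℝ) / 2 * (2 / N) = 1 := by field_simp
            rw [this, Real.rpow_one]
        _ ≤ _ := by gcongr
    rw [hDα, ← Real.rpow_natCast, radius_rpow, Real.rpow_neg hκ0.le, Real.rpow_neg hω.le]
    push_cast
    calc b * (M * (κ ^ (2 / (N : ℝ)))⁻¹ * (j : ℝ) ^ (-(2 / (N : ℝ))))
        = (j : ℝ) ^ (-(2 / (N : ℝ))) * (b * M / κ ^ (2 / (N : ℝ))) := by ring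
      _ ≤ _ := by
        gcongr
        rw [div_le_iff₀ (by positivity), inv_mul_eq_div, le_div_iff₀ (by positivity)]
        linarith
  have hblow' := hu.blow_up hN hα hα1 hw (τ₀ := 0) (D := D) (R := radius N j)
    (B := c * (κ * j * coneConst N)) le_rfl hD0 (by linarith) hρ hRD (by positivity) ?_
  · refine absurd hblow' (not_lt.2 (le_of_eq ?_))
    have e1 : κ ^ (2 / (N : ℝ)) * κ ^ (-(2 / (N : ℝ))) = 1 := by
      rw [← Real.rpow_add hκ0]; simp
    have e2 : (j : ℝ) ^ (2 / (N : ℝ)) * (j : ℝ) ^ (-(2 / (N : ℝ))) = 1 := by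
      rw [← Real.rpow_add hj0]; simp
    have e3 : (c * coneConst N) ^ (2 / (N : ℝ)) * M = blowConst N α a c := by
      rw [hM]; field_simp
    rw [hDα, show c * (κ * j * coneConst N) = c * coneConst N * κ * j by ring,
      Real.mul_rpow (by positivity) hj0.le, Real.mul_rpow (by positivity) hκ0.le]
    calc blowConst N α a c = ((c * coneConst N) ^ (2 / (N : ℝ)) * M) *
          (κ ^ (2 / (N : ℝ)) * κ ^ (-(2 / (N : ℝ)))) *
          ((j : ℝ) ^ (2 / (N : ℝ)) * (j : ℝ) ^ (-(2 / (N : ℝ)))) := by rw [e1, e2, e3]; ring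
      _ = _ := by ring
  · filter_upwards [hu.ae_eqn] with z hz hz1 hz2
    rw [zero_add] at hz1
    refine le_trans ?_ (hz ⟨hz1.1, by linarith [hz1.2]⟩).2.1
    rw [ENNReal.ofReal_mul hc.le]
    refine opP_lower hw fun θ hθ => ?_
    refine le_trans ?_ heat_initialDatum_lower
    rw [ENNReal.ofReal_mul (by positivity)]
    gcongr
    have hz0 : 0 < z.1 := hz1.1
    have hθ0 : 0 < θ := ha.trans hθ.1
    refine lintegral_heatKernel_self_ball (by positivity) ?_ hρ hz2
    have h3 : z.1 ^ α ≤ D ^ α := Real.rpow_le_rpow hz0.le hz1.2.le hα.le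
    calc z.1 ^ α * θ ≤ D ^ α * b := by
          gcongr
          exact hθ.2
      _ ≤ _ := by linarith

end TimeFracHeat

end

/-! ### Choice of the threshold `κ₁` -/

theorem mainTheorem8 (N : ℕ) (hN : 1 ≤ N) :
    ∃ κ₁ : ℝ → ℝ,
      (∀ α ∈ Set.Ioo (0 : ℝ) 1, 0 < κ₁ α) ∧
      (∀ α ∈ Set.Ioo (0 : ℝ) 1, ∀ κ : ℝ, κ₁ α < κ →
        ∃ Cκ : ℝ, 0 < Cκ ∧ ∀ j : ℕ, 1 ≤ j →
          TimeFracHeat.lifespan α (TimeFracHeat.fujita N) (TimeFracHeat.initialDatum N κ j) ≤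
            ENNReal.ofReal (Cκ * (j : ℝ) ^ (-(2 / (α * (N : ℝ)))))) ∧
      (∃ c C : ℝ, 0 < c ∧ c ≤ C ∧ ∀ᶠ α : ℝ in 𝓝[<] (1 : ℝ),
        c * (1 - α) ^ ((N : ℝ) / 2) ≤ κ₁ α ∧ κ₁ α ≤ C * (1 - α) ^ ((N : ℝ) / 2)) ∧
      (∀ α ∈ Set.Ioo (0 : ℝ) 1, ∃ K C : ℝ, 0 < K ∧ 0 < C ∧
        ∀ κ : ℝ, K < κ → ∀ j : ℕ, 1 ≤ j →
          TimeFracHeat.lifespan α (TimeFracHeat.fujita N) (TimeFracHeat.initialDatum N κ j) ≤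
            ENNReal.ofReal
              (C * κ ^ (-(2 / (α * (N : ℝ)))) * (j : ℝ) ^ (-(2 / (α * (N : ℝ)))))) := by
  open TimeFracHeat in
  have hloc : ∀ α : ℝ, ∃ k : ℝ, α ∈ Set.Ioo (0 : ℝ) 1 → 0 < k ∧ ∀ κ : ℝ, k < κ →
      ∃ C : ℝ, 0 < C ∧ ∀ j : ℕ, 1 ≤ j → lifespan α (fujita N) (initialDatum N κ j) ≤
        ENNReal.ofReal (C * (j : ℝ) ^ (-(2 / (α * (N : ℝ))))) := by
    intro α
    by_cases hα : α ∈ Set.Ioo (0 : ℝ) 1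
    · obtain ⟨a, b, c, hw⟩ := exists_wrightMass hα.1 hα.2
      obtain ⟨A, hA, h⟩ := exists_lifespan_bound_of_mass hN hα.1 hw.a_pos hw.b_pos hw.c_pos
      have h1α : 0 < 1 - α := by linarith [hα.2]
      exact ⟨A * (1 - α) ^ ((N : ℝ) / 2), fun _ => ⟨by positivity, h α le_rfl hα.2 hw⟩⟩
    · exact ⟨0, fun h => absurd h hα⟩
  choose k hk using hloc
  obtain ⟨A, hA, h⟩ := TimeFracHeat.exists_lifespan_bound_of_mass hN
    (by norm_num : (0 : ℝ) < 1 / 2) (by norm_num : (0 : ℝ) < 1 / 40) (Real.exp_pos Real.pi)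
    (by norm_num : (0 : ℝ) < 1 / 20)
  -- Uniform constants are available for `α > 1/2`; for smaller `α` any threshold, depending on `α`,
  -- will do.
  refine ⟨fun α => if 1 / 2 < α then A * (1 - α) ^ ((N : ℝ) / 2) else k α, ?_, ?_, ?_, ?_⟩
  · intro α hα
    have h1α : 0 < 1 - α := by linarith [hα.2]
    by_cases h2 : 1 / 2 < α
    · simp only [h2, if_true]; positivity
    · simp only [h2, if_false]; exact (hk α hα).1
  · intro α hα κ hκ
    by_cases h2 : 1 / 2 < α
    · simp only [h2, if_true] at hκ
      exact h α h2.le hα.2 (TimeFracHeat.wrightMass_uniform h2 hα.2) κ hκ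
    · simp only [h2, if_false] at hκ
      exact (hk α hα).2 κ hκ
  · refine ⟨A, A, hA, le_rfl, ?_⟩
    filter_upwards [mem_nhdsWithin_of_mem_nhds (lt_mem_nhds (by norm_num : (1 / 2 : ℝ) < 1))]
      with α hα
    simp only [hα, if_true, le_refl, and_self]
  · intro α hα
    obtain ⟨a, b, c, hw⟩ := TimeFracHeat.exists_wrightMass hα.1 hα.2
    exact TimeFracHeat.exists_lifespan_bound_large hN hα.1 hα.2 hw
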